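/- Let $k$ be an algebraically closed field, let $R = k[x,y,z]$ with its standard grading, and let $b \ge 2$ be an integer such that $\mathrm{char}(k)$ divides neither $2b+2$ nor $2b+1$. Let $$F = x^{2b+1}z + x^{b+1}y^{b+1} + y^{2b+1}z,$$ a square-free form of degree $d+1$, where $d = 2b+1$. Let $\mathrm{Syz}(J_F) = \{(s_1,s_2,s_3)\in R^3 : s_1F_x+s_2F_y+s_3F_z=0\}$. A minimal syzygy of $F$ is a nonzero homogeneous element $\epsilon \in \mathrm{Syz}(J_F)$ of smallest possible degree $e$. A Bourbaki ideal of $F$ associated with $\epsilon$ is an ideal $I_\epsilon \subseteq R$ whose elements have no common factor of positive degree and for which there is an exact sequence of graded $R$-modules $$0 \to R(-e) \xrightarrow{\ \epsilon\ } \mathrm{Syz}(J_F) \to I_\epsilon(e-d) \to 0 .$$ The Bourbaki degree $\mathrm{Bour}(F)$ is the degree of $R/I_\epsilon$ (computed from its Hilbert polynomial). For $P\in\mathbb P^2$ in an affine chart where a given coordinate is nonzero, the local Bourbaki degree at $P$ with respect to $\epsilon$ is the dimension over $k$ of $(A/J)_{\mathfrak m}$, where $A$ is the polynomial ring in the two other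 variables, $J\subseteq A$ is obtained from $I_\epsilon$ by setting the given variable equal to $1$, and $\mathfrak m$ is the maximal ideal of $A$ belonging to $P$. Then: 1. $\mathrm{Bour}(F) = b+4$; that is, Bourbaki ideals of $F$ exist, and for every minimal syzygy $\epsilon$ of $F$ and every Bourbaki ideal $I_\epsilon$ associated with it, $\deg(R/I_\epsilon) = b+4$. 2. The triple $$\epsilon_1 = \bigl(x(-(b+1)x^{b+1} - (2b+1)y^bz),\ \ y((b+1)x^{b+1}-(2b+1)y^bz),\ \ (2b+1)z((b+1)x^{b+1}+(2b+1)y^bz)\bigr)$$ is a minimal syzygy of $F$, of degree $b+2$. There is exactly one Bourbaki ideal $I_{\epsilon_1}$ associated with it. Its zeros in $\mathbb P^2$ are exactly the two points $P_1 = (0:1:0)$ and $P_2=(0:0:1)$, and the local Bourbaki degrees with respect to $\epsilon_1$ are $b+2$ at $P_1$ (in every affine chart containing $P_1$) and $2$ at $P_2$ (in every affine chart containing $P_2$). -/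

import Mathlib

open MvPolynomial

namespace Bourbaki

section Definitions

variable {k : Type*} [Field k]

/-- The module of first syzygies of the Jacobian ideal of `F`: the triples `s` with
`s 0 * F_x + s 1 * F_y + s 2 * F_z = 0`. -/
noncomputable def syz (F : MvPolynomial (Fin 3) k) :
    Submodule (MvPolynomial (Fin 3) k) (Fin 3 → MvPolynomial (Fin 3) k) :=
  LinearMap.ker
    (Fintype.linearCombination (MvPolynomial (Fin 3) k) (fun i => pderiv i F))

/-- A triple is homogeneous of degree `t` if each of its entries is. -/
def IsHomogeneousTriple (s : Fin 3 → MvPolynomial (Fin 3) k) (t : ℕ) : Prop :=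
  ∀ i, (s i).IsHomogeneous t

/-- `ε` is a minimal syzygy of degree `e`: a nonzero homogeneous syzygy of degree `e`, where `e` is
the smallest degree of a nonzero homogeneous syzygy (that is, the smallest degree that occurs in a
homogeneous generating set). -/
structure IsMinimalSyzygy (F : MvPolynomial (Fin 3) k) (ε : Fin 3 → MvPolynomial (Fin 3) k)
    (e : ℕ) : Prop where
  mem : ε ∈ syz F
  ne_zero : ε ≠ 0
  homogeneous : IsHomogeneousTriple ε e
  minimal : ∀ s ∈ syz F, s ≠ 0 → ∀ t : ℕ, IsHomogeneousTriple s t → e ≤ t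

/-- `I` is the Bourbaki ideal of the curve `F = 0`, of degree `d + 1`, associated with the minimal
syzygy `ε` of degree `e`: there is an exact sequence of graded modules
`0 ⟶ R(-e) ⟶ Syz(J_F) ⟶ I(e - d) ⟶ 0`, the first map being multiplication by `ε` and the second
one being `φ` below, and the elements of `I` have no common factor. That `φ` is graded says
that a syzygy of degree `t` is sent to a form of degree `t + e - d`; this is written without
subtraction, with `d + 1 = F.totalDegree`. -/
def IsBourbakiIdeal (F : MvPolynomial (Fin 3) k) (ε : Fin 3 → MvPolynomial (Fin 3) k)
    (I : Ideal (MvPolynomial (Fin 3) k)) : Prop :=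
  ∃ e : ℕ, IsMinimalSyzygy F ε e ∧
    (∀ g : MvPolynomial (Fin 3) k, (∀ f ∈ I, g ∣ f) → IsUnit g) ∧
    ∃ φ : syz F →ₗ[MvPolynomial (Fin 3) k] MvPolynomial (Fin 3) k,
      LinearMap.range φ = I ∧
      (∀ s : syz F, φ s = 0 ↔
        ∃ r : MvPolynomial (Fin 3) k, (s : Fin 3 → MvPolynomial (Fin 3) k) = r • ε) ∧
      (∀ (s : syz F) (t : ℕ), IsHomogeneousTriple (s : Fin 3 → MvPolynomial (Fin 3) k) t →
        ∀ m ∈ (φ s).support, m.degree + F.totalDegree = t + e + 1)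

/-- The Hilbert function of `R/I`: the dimension of the image in `R/I` of the space of forms of
degree `n` (for homogeneous `I` this image is the degree `n` part of `R/I`). -/
noncomputable def hilbertFunction (I : Ideal (MvPolynomial (Fin 3) k)) (n : ℕ) : ℕ :=
  Module.finrank k
    ((homogeneousSubmodule (Fin 3) k n).map (Ideal.Quotient.mkₐ k I).toLinearMap)

/-- `R/I` has degree `δ`: if `p` is the Hilbert polynomial of `R/I` and `r` its degree, then
`δ` is `r !` times the leading coefficient of `p` (and `0` if `p = 0`). -/
def HasDegree (I : Ideal (MvPolynomial (Fin 3) k)) (δ : ℕ) : Prop :=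
  ∃ p : Polynomial ℚ,
    (∀ᶠ n : ℕ in Filter.atTop, (hilbertFunction I n : ℚ) = p.eval (n : ℚ)) ∧
    p.leadingCoeff * (Nat.factorial p.natDegree : ℚ) = δ

/-- `Bour(F) = δ`: Bourbaki ideals of `F` exist, and for every minimal syzygy `ε` and every
Bourbaki ideal `I` associated with it, the degree of `R/I` is `δ`. -/
def HasBourbakiDegree (F : MvPolynomial (Fin 3) k) (δ : ℕ) : Prop :=
  (∃ ε I, IsBourbakiIdeal F ε I) ∧ ∀ ε I, IsBourbakiIdeal F ε I → HasDegree I δ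

/-- The zeros in the projective plane of a homogeneous ideal. -/
def zeros (I : Ideal (MvPolynomial (Fin 3) k)) :
    Set (Projectivization k (Fin 3 → k)) :=
  {P | ∀ (v : Fin 3 → k) (hv : v ≠ 0), Projectivization.mk k v hv = P →
    ∀ f ∈ I, eval v f = 0}

/-- Dehomogenization with respect to the `i`-th variable: set `X i = 1`, keep the others. -/
noncomputable def dehomogenize (i : Fin 3) :
    MvPolynomial (Fin 3) k →ₐ[k] MvPolynomial {j : Fin 3 // j ≠ i} k :=
  aeval (fun j => if h : j = i then 1 else X ⟨j, h⟩)

/-- The ideal `⟨X_j - a_j⟩` of the point `a` of affine space. -/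
noncomputable def pointIdeal {σ : Type*} (a : σ → k) : Ideal (MvPolynomial σ k) :=
  Ideal.span (Set.range fun j => X j - C (a j))

theorem pointIdeal_eq_ker {σ : Type*} (a : σ → k) :
    pointIdeal a = RingHom.ker (eval a) := by
  apply le_antisymm
  · rw [pointIdeal, Ideal.span_le]
    rintro _ ⟨j, rfl⟩
    simp [RingHom.mem_ker]
  · intro f hf
    have key : ∀ g : MvPolynomial σ k, g - C (eval a g) ∈ pointIdeal a := by
      intro g
      induction g using MvPolynomial.induction_on with
      | C c => simp
      | add p q hp hq =>
        have h := Ideal.add_mem _ hp hq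
        have e : p + q - C (eval a (p + q)) = p - C (eval a p) + (q - C (eval a q)) := by
          simp only [map_add]; ring
        rw [e]; exact h
      | mul_X p j hp =>
        have hj : (X j - C (a j) : MvPolynomial σ k) ∈ pointIdeal a :=
          Ideal.subset_span ⟨j, rfl⟩
        have h := Ideal.add_mem _ (Ideal.mul_mem_left _ p hj)
          (Ideal.mul_mem_left _ (C (a j)) hp)
        have e : p * X j - C (eval a (p * X j))
            = p * (X j - C (a j)) + C (a j) * (p - C (eval a p)) := by
          simp only [map_mul, eval_X]; ring
        rw [e]; exact h
    have h := key f
    rw [RingHom.mem_ker] at hf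
    simpa [hf] using h

instance pointIdeal_isPrime {σ : Type*} (a : σ → k) : (pointIdeal a).IsPrime := by
  rw [pointIdeal_eq_ker]
  exact RingHom.ker_isPrime _

/-- The dimension over `k` of the localization of `k[x_j : j ≠ i] / J` at the point with
homogeneous coordinates `v`, where `v i ≠ 0` and `J` is the dehomogenization of `I` with respect
to the `i`-th variable. -/
noncomputable def localDegree (I : Ideal (MvPolynomial (Fin 3) k)) (i : Fin 3)
    (v : Fin 3 → k) : ℕ :=
  Module.finrank k
    (Localization
      ((pointIdeal (fun j : {j : Fin 3 // j ≠ i} => v j / v i)).primeCompl.map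
        (Ideal.Quotient.mk (I.map (dehomogenize i)))))

/-- The local degree of `R/I` at the point `P` of the projective plane is `δ`. For the Bourbaki
ideal `I` associated with a minimal syzygy of `F`, this is the local Bourbaki degree at `P`.
It is asked for in every affine chart that contains `P` (there is at least one). -/
def HasLocalDegree (I : Ideal (MvPolynomial (Fin 3) k))
    (P : Projectivization k (Fin 3 → k)) (δ : ℕ) : Prop :=
  ∀ (v : Fin 3 → k) (hv : v ≠ 0), Projectivization.mk k v hv = P →
    ∀ i : Fin 3, v i ≠ 0 → localDegree I i v = δ

/-- The polynomial `x^(2b+1) z + x^(b+1) y^(b+1) + y^(2b+1) z`. -/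
noncomputable def curve (k : Type*) [Field k] (b : ℕ) : MvPolynomial (Fin 3) k :=
  X 0 ^ (2 * b + 1) * X 2 + X 0 ^ (b + 1) * X 1 ^ (b + 1) + X 1 ^ (2 * b + 1) * X 2

/-- The syzygy
`(x (-(b+1) x^(b+1) - (2b+1) y^b z), y ((b+1) x^(b+1) - (2b+1) y^b z),
  (2b+1) z ((b+1) x^(b+1) + (2b+1) y^b z))`
of the partial derivatives of `curve k b`. -/
noncomputable def curveSyzygy (k : Type*) [Field k] (b : ℕ) :
    Fin 3 → MvPolynomial (Fin 3) k :=
  ![X 0 * (-(C ((b : k) + 1) * X 0 ^ (b + 1)) - C (2 * (b : k) + 1) * (X 1 ^ b * X 2)),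
    X 1 * (C ((b : k) + 1) * X 0 ^ (b + 1) - C (2 * (b : k) + 1) * (X 1 ^ b * X 2)),
    C (2 * (b : k) + 1) * X 2 *
      (C ((b : k) + 1) * X 0 ^ (b + 1) + C (2 * (b : k) + 1) * (X 1 ^ b * X 2))]

/-- The point `(0 : 1 : 0)`. -/
def pointY (k : Type*) [Field k] : Projectivization k (Fin 3 → k) :=
  Projectivization.mk k ![0, 1, 0] (fun h => one_ne_zero (congrFun h 1))

/-- The point `(0 : 0 : 1)`. -/
def pointZ (k : Type*) [Field k] : Projectivization k (Fin 3 → k) :=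
  Projectivization.mk k ![0, 0, 1] (fun h => one_ne_zero (congrFun h 2))

end Definitions

end Bourbaki

/-!
Write `a = b + 1`, `c = 2 b + 1`, `ε` for `curveSyzygy k b`, and `M = a x^(b+1) - c y^b z`,
`H = a x^(b+1) + c y^b z`. For a syzygy `s` of `F = curve k b` the cross product of `ε` and `s` is
orthogonal to the same two triples as the gradient of `F`, hence equal to `φ(s)` times the gradient.
Comparing second entries gives `y^b φ(s) = c z s₀ + x s₂`, and this is how `φ` is defined here
(`curveMap`): the equation of the syzygies, read modulo `y^b`, shows that `y^b` divides the
right-hand side. Eliminating leads to a linear system for `(φ(s), s₀, s₁, s₂)`, called `IsSolution`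
below, from which everything is read off.

* The kernel of `φ` is `R ε`, because `H` is prime to `x` and `y`
  (`exists_of_isSolution_zero`).
* The image of `φ` is `I = (M, x y z, x² z, y z²)`. Explicit syzygies are mapped to multiples of the
  generators (`exists_isSolution_of_mem`). Conversely, reducing the system modulo `z`, `x` and `y`
  in turn, one divisibility after the other is forced on `φ(s)`
  (`mem_curveIdeal_of_isSolution`).

Hence `I` is a Bourbaki ideal for `ε`. It contains no form of degree less than `3`, and since `φ`
lowers degrees by `b - 1`, no syzygy has degree less than `b + 2`. Two maps with the same kernel
`R ε` are proportional over the fraction field, so an image without common factor is unique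
(`range_eq_of_ker_eq`).

A different minimal syzygy has the same degree `e`, and the exact sequence expresses the Hilbert
function of the quotient by its Bourbaki ideal, in large degrees, through the dimensions of `R_n`,
`R_m` and `Syz(J_F)_t` alone (`IsBourbakiIdeal.hilbertFunction_add_finrank`). So the Bourbaki degree
can be computed from `I`. There, in degrees `n ≥ b + 2`, the forms in `I` are cut out by `b + 4`
independent conditions: vanishing to order `b + 2` along the branch `z = (a / c) x^(b+1)` at
`(0 : 1 : 0)`, and to order `2` along the line `y = 0` at `(0 : 0 : 1)`
(`hilbertFunction_curveIdeal`). The same two curves identify the dehomogenizations of `R/I` in the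
charts `y = 1` and `z = 1` with `k[u]/(u^(b+2))` and `k[u]/(u^2)`. These rings are local already, so
localizing at the point changes nothing (`finrank_localization_eq`).
-/

namespace Bourbaki

variable {k : Type*} [Field k]

/-! ### Setting a variable equal to zero -/

/-- The substitution `X i ↦ 0`, as an endomorphism of `k[x, y, z]`. -/
noncomputable def setZero (i : Fin 3) :
    MvPolynomial (Fin 3) k →ₐ[k] MvPolynomial (Fin 3) k :=
  aeval (fun j => if j = i then 0 else X j)

@[simp] lemma setZero_X_self (i : Fin 3) : setZero i (X i : MvPolynomial (Fin 3) k) = 0 := by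
  simp [setZero]

lemma setZero_X_of_ne {i j : Fin 3} (h : j ≠ i) :
    setZero i (X j : MvPolynomial (Fin 3) k) = X j := by
  simp [setZero, h]

@[simp] lemma setZero_C (i : Fin 3) (r : k) : setZero i (C r) = C r := by
  simp [setZero, algebraMap_eq]

lemma X_dvd_sub_setZero (i : Fin 3) (f : MvPolynomial (Fin 3) k) : X i ∣ f - setZero i f := by
  induction f using MvPolynomial.induction_on with
  | C r => simp
  | add p q hp hq =>
    have := dvd_add hp hq
    rw [map_add]
    convert this using 1
    ring
  | mul_X p j hp =>
    by_cases hj : j = i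
    · subst hj
      simp
    · rw [map_mul, setZero_X_of_ne hj, ← sub_mul]
      exact hp.mul_right _

lemma setZero_eq_zero_of_dvd {i : Fin 3} {f : MvPolynomial (Fin 3) k} (h : X i ∣ f) :
    setZero i f = 0 := by
  obtain ⟨g, rfl⟩ := h
  simp

lemma isRelPrime_X_of_setZero_ne {i : Fin 3} {f : MvPolynomial (Fin 3) k}
    (h : setZero i f ≠ 0) : IsRelPrime (X i) f :=
  (MvPolynomial.X_prime (R := k) (i := i)).irreducible.isRelPrime_iff_not_dvd.2
    fun hd => h (setZero_eq_zero_of_dvd hd)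

lemma isRelPrime_X_X {i j : Fin 3} (h : i ≠ j) :
    IsRelPrime (X i : MvPolynomial (Fin 3) k) (X j) :=
  isRelPrime_X_of_setZero_ne (by rw [setZero_X_of_ne h.symm]; exact X_ne_zero j)

/-- If `X i` divides `D * f` modulo `E`, where neither `D` nor `E` involves `X i` and `E` is prime
to `D`, then `f` lies in the ideal generated by `X i` and `E`. -/
lemma exists_eq_X_mul_add_mul {i : Fin 3} {D E f p q : MvPolynomial (Fin 3) k}
    (hD : setZero i D = D) (hE : setZero i E = E) (hDE : IsRelPrime E D)
    (h : D * f = X i * p + E * q) : ∃ p' q', f = X i * p' + E * q' := by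
  have h1 := congrArg (setZero i) h
  simp only [map_mul, map_add, hD, hE, setZero_X_self, zero_mul, zero_add] at h1
  obtain ⟨q', hq'⟩ := hDE.dvd_of_dvd_mul_left ⟨_, h1⟩
  obtain ⟨p', hp'⟩ := X_dvd_sub_setZero i f
  exact ⟨p', q', by rw [← hp', ← hq']; ring⟩

/-! ### The linear system of the syzygies -/

/-- For a syzygy `(s₀, s₁, s₂)` of `curve k b` the form `h` such that the cross product of
`curveSyzygy k b` with the syzygy is `h` times the gradient is determined by these two equations,
where `a = b + 1` and `c = 2 b + 1`. The first one reads off `h`; eliminating `h` between the two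
returns the equation of the syzygies. -/
def IsSolution (a c : k) (b : ℕ) (h s₀ s₁ s₂ : MvPolynomial (Fin 3) k) : Prop :=
  X 1 ^ b * h = C c * X 2 * s₀ + X 0 * s₂ ∧
  X 0 ^ (2 * b) * h + C a * X 0 ^ b * X 1 * s₀
    + (C c * X 1 ^ b * X 2 + C a * X 0 ^ (b + 1)) * s₁ + X 1 ^ (b + 1) * s₂ = 0

/-- The ideal `(a x^(b+1) - c y^b z, x y z, x² z, y z²)`. -/
noncomputable def curveIdeal (a c : k) (b : ℕ) : Ideal (MvPolynomial (Fin 3) k) :=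
  Ideal.span {C a * X 0 ^ (b + 1) - C c * X 1 ^ b * X 2, X 0 * X 1 * X 2, X 0 ^ 2 * X 2,
    X 1 * X 2 ^ 2}

section Generators

variable (a c : k) (b : ℕ)

lemma binomial_mem_curveIdeal :
    C a * X 0 ^ (b + 1) - C c * X 1 ^ b * X 2 ∈ curveIdeal a c b :=
  Ideal.subset_span (by simp)

lemma xyz_mem_curveIdeal : X 0 * X 1 * X 2 ∈ curveIdeal a c b :=
  Ideal.subset_span (by simp)

lemma xxz_mem_curveIdeal : X 0 ^ 2 * X 2 ∈ curveIdeal a c b :=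
  Ideal.subset_span (by simp)

lemma yzz_mem_curveIdeal : X 1 * X 2 ^ 2 ∈ curveIdeal a c b :=
  Ideal.subset_span (by simp)

end Generators

lemma IsSolution.add {a c : k} {b : ℕ} {h s₀ s₁ s₂ h' t₀ t₁ t₂ : MvPolynomial (Fin 3) k}
    (H : IsSolution a c b h s₀ s₁ s₂) (H' : IsSolution a c b h' t₀ t₁ t₂) :
    IsSolution a c b (h + h') (s₀ + t₀) (s₁ + t₁) (s₂ + t₂) :=
  ⟨by linear_combination H.1 + H'.1, by linear_combination H.2 + H'.2⟩

lemma IsSolution.mul {a c : k} {b : ℕ} {h s₀ s₁ s₂ : MvPolynomial (Fin 3) k}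
    (H : IsSolution a c b h s₀ s₁ s₂) (r : MvPolynomial (Fin 3) k) :
    IsSolution a c b (r * h) (r * s₀) (r * s₁) (r * s₂) :=
  ⟨by linear_combination r * H.1, by linear_combination r * H.2⟩

section

variable {a c : k} {b : ℕ}

lemma C_mul_C_inv {r : k} (hr : r ≠ 0) :
    (C r * C r⁻¹ : MvPolynomial (Fin 3) k) = 1 := by
  rw [← C_mul, mul_inv_cancel₀ hr, C_1]

lemma isSolution_xyz (a c : k) (b : ℕ) :
    IsSolution a c b (C (2 * a * c) * (X 0 * X 1 * X 2))
      (X 0 * (C a * X 1 ^ (b + 1) - C c * X 0 ^ b * X 2))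
      (-X 1 * (C c * X 0 ^ b * X 2 + C a * X 1 ^ (b + 1)))
      (C c * X 2 * (C c * X 0 ^ b * X 2 + C a * X 1 ^ (b + 1))) := by
  constructor <;> simp only [C_mul, map_ofNat] <;> ring

lemma isSolution_xxz (a c : k) (n : ℕ) :
    IsSolution a c (n + 1) (C (2 * a ^ 2 * c) * (X 0 ^ 2 * X 2))
      (C (2 * a ^ 2) * X 0 ^ 2 * X 1 ^ (n + 1)
        - X 0 * (C (a ^ 2) * X 0 * X 1 ^ (n + 1) - C (c ^ 2) * X 1 ^ n * X 2 ^ 2))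
      (-X 1 * (C (a ^ 2) * X 0 * X 1 ^ (n + 1) - C (c ^ 2) * X 1 ^ n * X 2 ^ 2)
        - C (2 * a * c) * X 0 ^ (n + 2) * X 2)
      (C c * X 2 * (C (a ^ 2) * X 0 * X 1 ^ (n + 1) - C (c ^ 2) * X 1 ^ n * X 2 ^ 2)) := by
  constructor <;> simp only [C_mul, C_pow, map_ofNat] <;> ring

lemma isSolution_yzz (a c : k) (n : ℕ) :
    IsSolution a c (n + 1) (C (2 * a * c ^ 2) * (X 1 * X 2 ^ 2))
      (C (2 * a * c) * X 1 ^ (n + 2) * X 2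
        - X 0 * (C (c ^ 2) * X 0 ^ n * X 2 ^ 2 - C (a ^ 2) * X 0 ^ (n + 1) * X 1))
      (-X 1 * (C (c ^ 2) * X 0 ^ n * X 2 ^ 2 - C (a ^ 2) * X 0 ^ (n + 1) * X 1)
        - C (2 * a ^ 2) * X 0 ^ (n + 1) * X 1 ^ 2)
      (C c * X 2 * (C (c ^ 2) * X 0 ^ n * X 2 ^ 2 - C (a ^ 2) * X 0 ^ (n + 1) * X 1)) := by
  constructor <;> simp only [C_mul, C_pow, map_ofNat] <;> ring

lemma isSolution_binomial (a c : k) (n : ℕ) :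
    IsSolution a c (n + 1) (C a * (C a * X 0 ^ (n + 2) - C c * X 1 ^ (n + 1) * X 2))
      (-C a * X 1 ^ (2 * n + 2) + C c * X 0 ^ (n + 1) * X 1 ^ n * X 2)
      (-X 0 ^ n * (C a * X 0 ^ (n + 2) - C c * X 1 ^ (n + 1) * X 2))
      (C (a ^ 2) * X 0 ^ (n + 1) * X 1 ^ (n + 1) - C (c ^ 2) * X 0 ^ n * X 1 ^ n * X 2 ^ 2) := by
  constructor <;> simp only [C_pow] <;> ring

/-- Every element of `curveIdeal a c b` is the `h` of a solution. -/
lemma exists_isSolution_of_mem (ha : a ≠ 0) (hc : c ≠ 0) (h2 : (2 : k) ≠ 0) (hb : 1 ≤ b)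
    {h : MvPolynomial (Fin 3) k} (hh : h ∈ curveIdeal a c b) :
    ∃ s₀ s₁ s₂, IsSolution a c b h s₀ s₁ s₂ := by
  obtain ⟨n, rfl⟩ : ∃ n, b = n + 1 := ⟨b - 1, by omega⟩
  have scale : ∀ {r : k} {g s₀ s₁ s₂ : MvPolynomial (Fin 3) k}, r ≠ 0 →
      IsSolution a c (n + 1) (C r * g) s₀ s₁ s₂ → ∃ s₀ s₁ s₂, IsSolution a c (n + 1) g s₀ s₁ s₂ := by
    intro r g s₀ s₁ s₂ hr H
    have H' := H.mul (C r⁻¹)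
    have e : C r⁻¹ * (C r * g) = g := by linear_combination g * C_mul_C_inv hr
    rw [e] at H'
    exact ⟨_, _, _, H'⟩
  refine Submodule.span_induction ?_ ?_ ?_ ?_ hh
  · rintro g (rfl | rfl | rfl | rfl)
    · exact scale ha (isSolution_binomial a c n)
    · exact scale (by simp [ha, hc, h2]) (isSolution_xyz a c (n + 1))
    · exact scale (by simp [ha, hc, h2]) (isSolution_xxz a c n)
    · exact scale (by simp [ha, hc, h2]) (isSolution_yzz a c n)
  · exact ⟨0, 0, 0, by simp [IsSolution]⟩
  · rintro f g - - ⟨s₀, s₁, s₂, H⟩ ⟨t₀, t₁, t₂, H'⟩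
    exact ⟨_, _, _, H.add H'⟩
  · rintro r f - ⟨s₀, s₁, s₂, H⟩
    exact ⟨_, _, _, H.mul r⟩

lemma C_mul_dvd_iff {r : k} (hr : r ≠ 0) (f g : MvPolynomial (Fin 3) k) :
    f ∣ C r * g ↔ f ∣ g := by
  refine ⟨fun h => ?_, fun h => h.mul_left _⟩
  have e : g = C r⁻¹ * (C r * g) := by linear_combination -g * C_mul_C_inv hr
  rw [e]
  exact h.mul_left _

lemma isRelPrime_X_zero_trinomial (a : k) (hc : c ≠ 0) :
    IsRelPrime (X 0) (C c * X 1 ^ b * X 2 + C a * X 0 ^ (b + 1) : MvPolynomial (Fin 3) k) := by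
  apply isRelPrime_X_of_setZero_ne
  simp [setZero_X_of_ne, hc]

/-- If `z β` is the `h` of a solution, then some `G β + H w` is divisible by `x y`, where
`G = c x^b z + a y^(b+1)` and `H = c y^b z + a x^(b+1)`. -/
lemma exists_relation_of_isSolution (hc : c ≠ 0) {β s₀ s₁ s₂ : MvPolynomial (Fin 3) k}
    (H : IsSolution a c b (X 2 * β) s₀ s₁ s₂) :
    ∃ t w, (C c * X 0 ^ b * X 2 + C a * X 1 ^ (b + 1)) * β
      + (C c * X 1 ^ b * X 2 + C a * X 0 ^ (b + 1)) * w = C (2 * a) * (X 0 * X 1 * t) := by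
  obtain ⟨H1, H2⟩ := H
  have hz : X 2 ∣ X 0 * s₂ := ⟨X 1 ^ b * β - C c * s₀, by linear_combination -H1⟩
  obtain ⟨t, rfl⟩ := (isRelPrime_X_X (by decide)).dvd_of_dvd_mul_left hz
  have H3 : X 1 ^ b * β = C c * s₀ + X 0 * t :=
    mul_left_cancel₀ (X_ne_zero (R := k) (2 : Fin 3)) (by linear_combination H1)
  have H4 : X 0 ^ b * ((C c * X 0 ^ b * X 2 + C a * X 1 ^ (b + 1)) * β
      - C (2 * a) * (X 0 * X 1 * t))
      + (C c * X 1 ^ b * X 2 + C a * X 0 ^ (b + 1)) * (X 1 * t + C c * s₁) = 0 := by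
    simp only [C_mul, map_ofNat]
    linear_combination C c * H2 + C a * X 0 ^ b * X 1 * H3
  have hx : X 0 ^ b ∣ (C c * X 1 ^ b * X 2 + C a * X 0 ^ (b + 1)) * (X 1 * t + C c * s₁) :=
    ⟨-((C c * X 0 ^ b * X 2 + C a * X 1 ^ (b + 1)) * β - C (2 * a) * (X 0 * X 1 * t)), by
      linear_combination H4⟩
  obtain ⟨w, hw⟩ := ((isRelPrime_X_zero_trinomial a hc).pow_left).dvd_of_dvd_mul_left hx
  refine ⟨t, w, mul_left_cancel₀ (pow_ne_zero b (X_ne_zero (R := k) (0 : Fin 3))) ?_⟩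
  rw [hw] at H4
  linear_combination H4

/-- A relation as in `exists_relation_of_isSolution`, read modulo `y`: the coefficient of `G` is
divisible by `x` modulo `y`. -/
lemma X_zero_dvd_setZero_one (hc : c ≠ 0) {β w t : MvPolynomial (Fin 3) k}
    (h : (C c * X 0 ^ b * X 2 + C a * X 1 ^ (b + 1)) * β
      + (C c * X 1 ^ b * X 2 + C a * X 0 ^ (b + 1)) * w = X 1 * t) (hb : 1 ≤ b) :
    X 0 ∣ setZero 1 β := by
  have h1 := congrArg (setZero 1) h
  simp only [map_mul, map_add, map_pow, setZero_C, setZero_X_self, zero_mul,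
    setZero_X_of_ne (show (0 : Fin 3) ≠ 1 by decide),
    setZero_X_of_ne (show (2 : Fin 3) ≠ 1 by decide),
    zero_pow (show b ≠ 0 by omega), zero_pow (show b + 1 ≠ 0 by omega), mul_zero, add_zero,
    zero_add] at h1
  have h2 : X 2 * (C c * setZero 1 β) = X 0 * (-C a * setZero 1 w) :=
    mul_left_cancel₀ (pow_ne_zero b (X_ne_zero (R := k) (0 : Fin 3))) (by linear_combination h1)
  exact (C_mul_dvd_iff hc _ _).1 ((isRelPrime_X_X (by decide)).dvd_of_dvd_mul_left ⟨_, h2⟩)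

/-- The `h` of a solution lies in `curveIdeal a c b`. -/
lemma mem_curveIdeal_of_isSolution (ha : a ≠ 0) (hc : c ≠ 0) (h2 : (2 : k) ≠ 0) (hb : 1 ≤ b)
    {h s₀ s₁ s₂ : MvPolynomial (Fin 3) k} (H : IsSolution a c b h s₀ s₁ s₂) :
    h ∈ curveIdeal a c b := by
  have x0 : (X 0 : MvPolynomial (Fin 3) k) ≠ 0 := X_ne_zero _
  have r01 : IsRelPrime (X 0 : MvPolynomial (Fin 3) k) (X 1) := isRelPrime_X_X (by decide)
  have r20 : IsRelPrime (X 2 : MvPolynomial (Fin 3) k) (X 0) := isRelPrime_X_X (by decide)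
  have n01 : (0 : Fin 3) ≠ 1 := by decide
  have n12 : (1 : Fin 3) ≠ 2 := by decide
  have n02 : (0 : Fin 3) ≠ 2 := by decide
  -- `h` lies in `(x, z)`
  obtain ⟨β, α, rfl⟩ : ∃ β α, h = X 2 * β + X 0 * α :=
    exists_eq_X_mul_add_mul (D := X 1 ^ b) (p := C c * s₀) (q := s₂)
      (by simp [setZero_X_of_ne n12]) (setZero_X_of_ne n02) r01.pow_right
      (by linear_combination H.1)
  have H' := H
  obtain ⟨H1, H2⟩ := H'
  -- `α` lies in `(z, x ^ b)`
  obtain ⟨t, ht⟩ : X 2 ∣ s₂ - X 1 ^ b * α :=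
    r20.dvd_of_dvd_mul_left ⟨X 1 ^ b * β - C c * s₀, by linear_combination -H1⟩
  obtain ⟨p, q, rfl⟩ : ∃ p q, α = X 2 * p + X 0 ^ b * q := by
    refine exists_eq_X_mul_add_mul (D := X 1 ^ (2 * b + 1))
      (p := -(C c * X 1 ^ b * s₁ + X 1 ^ (b + 1) * t))
      (q := -(X 0 ^ b * (X 2 * β + X 0 * α) + C a * X 1 * s₀ + C a * X 0 * s₁))
      (by simp [setZero_X_of_ne n12]) (by simp [setZero_X_of_ne n02])
      (r01.pow_left.pow_right) ?_
    linear_combination H2 - X 1 ^ (b + 1) * ht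
  -- subtract a multiple of the binomial, to get a multiple of `z`
  obtain ⟨t₀, t₁, t₂, T⟩ := exists_isSolution_of_mem ha hc h2 hb
    (Ideal.mul_mem_left _ (-C a⁻¹ * q) (binomial_mem_curveIdeal a c b))
  have H3 := H.add T
  suffices hz : ∀ γ s₀ s₁ s₂, IsSolution a c b (X 2 * γ) s₀ s₁ s₂ →
      X 2 * γ ∈ curveIdeal a c b by
    have e : X 2 * β + X 0 * (X 2 * p + X 0 ^ b * q)
        + -C a⁻¹ * q * (C a * X 0 ^ (b + 1) - C c * X 1 ^ b * X 2)
        = X 2 * (β + X 0 * p + C a⁻¹ * C c * q * X 1 ^ b) := by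
      linear_combination (-q * X 0 ^ (b + 1)) * C_mul_C_inv ha
    rw [e] at H3
    have h4 := hz _ _ _ _ H3
    rw [← e] at h4
    exact (Ideal.add_mem_iff_left _ (Ideal.mul_mem_left _ _ (binomial_mem_curveIdeal a c b))).1 h4
  clear H3 T t₀ t₁ t₂ H1 H2 H ht
  intro γ s₀ s₁ s₂ H
  obtain ⟨t, w, h1⟩ := exists_relation_of_isSolution hc H
  -- modulo `x`, the form `γ` is divisible by `z`
  obtain ⟨u, v, rfl⟩ : ∃ u v, γ = X 0 * u + X 2 * v := by
    refine exists_eq_X_mul_add_mul (D := C a * X 1 ^ (b + 1))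
      (p := C (2 * a) * (X 1 * t) - C c * X 0 ^ (b - 1) * X 2 * γ - C a * X 0 ^ b * w)
      (q := -C c * X 1 ^ b * w)
      (by simp [setZero_X_of_ne n01.symm]) (setZero_X_of_ne n02.symm) ?_ ?_
    · have : IsRelPrime (X 2 : MvPolynomial (Fin 3) k) (X 1 ^ (b + 1)) :=
        (isRelPrime_X_X n12.symm).pow_right
      intro d hd hd'
      exact this hd ((C_mul_dvd_iff ha _ _).1 hd')
    · obtain ⟨n, rfl⟩ : ∃ n, b = n + 1 := ⟨b - 1, by omega⟩
      simp only [Nat.add_sub_cancel]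
      linear_combination h1
  -- modulo `y`, it is divisible by `x`, so `v` lies in `(x, y)`
  have hγ : X 0 ∣ setZero 1 (X 0 * u + X 2 * v) :=
    X_zero_dvd_setZero_one (a := a) (t := C (2 * a) * (X 0 * t)) (w := w) hc
      (by linear_combination h1) hb
  have hv : X 0 ∣ setZero 1 v := by
    simp only [map_add, map_mul, setZero_X_of_ne n01, setZero_X_of_ne n12.symm] at hγ
    exact r20.symm.dvd_of_dvd_mul_left ((dvd_add_right (dvd_mul_right _ _)).1 hγ)
  obtain ⟨v₀, hv₀⟩ := hv
  obtain ⟨v₁, hv₁⟩ := X_dvd_sub_setZero 1 v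
  obtain rfl : v = X 0 * v₀ + X 1 * v₁ := by linear_combination hv₁ + hv₀
  -- subtract a multiple of `y z²`, to get a multiple of `x z`
  obtain ⟨t₀, t₁, t₂, T⟩ := exists_isSolution_of_mem ha hc h2 hb
    (Ideal.mul_mem_left _ (-v₁) (yzz_mem_curveIdeal a c b))
  have H3 := H.add T
  have e : X 2 * (X 0 * u + X 2 * (X 0 * v₀ + X 1 * v₁)) + -v₁ * (X 1 * X 2 ^ 2)
      = X 2 * (X 0 * (u + X 2 * v₀)) := by ring
  rw [e] at H3
  rw [← Ideal.add_mem_iff_left _ (Ideal.mul_mem_left _ (-v₁) (yzz_mem_curveIdeal a c b)), e]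
  generalize u + X 2 * v₀ = δ at H3
  obtain ⟨t', w', h3⟩ := exists_relation_of_isSolution hc H3
  obtain ⟨w'', rfl⟩ : X 0 ∣ w' := by
    refine (isRelPrime_X_zero_trinomial (b := b) a hc).dvd_of_dvd_mul_left
      ⟨C (2 * a) * (X 1 * t') - (C c * X 0 ^ b * X 2 + C a * X 1 ^ (b + 1)) * δ, ?_⟩
    linear_combination h3
  have hδ : X 0 ∣ setZero 1 δ :=
    X_zero_dvd_setZero_one (a := a) (t := C (2 * a) * t') (w := w'') hc
      (mul_left_cancel₀ x0 (by linear_combination h3)) hb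
  obtain ⟨d₀, hd₀⟩ := hδ
  obtain ⟨d₁, hd₁⟩ := X_dvd_sub_setZero 1 δ
  have e' : X 2 * (X 0 * δ) = d₀ * (X 0 ^ 2 * X 2) + d₁ * (X 0 * X 1 * X 2) := by
    linear_combination X 2 * X 0 * (hd₁ + hd₀)
  rw [e']
  exact Ideal.add_mem _ (Ideal.mul_mem_left _ _ (xxz_mem_curveIdeal a c b))
    (Ideal.mul_mem_left _ _ (xyz_mem_curveIdeal a c b))

end

/-! ### Ideals without common factor -/

lemma dvd_of_forall_dvd_mul {R : Type*} [CommRing R] [IsDomain R] [UniqueFactorizationMonoid R]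
    {S : Set R} (hS : ∀ d, (∀ f ∈ S, d ∣ f) → IsUnit d) {g u : R} (h : ∀ f ∈ S, g ∣ f * u) :
    g ∣ u := by
  rcases eq_or_ne u 0 with rfl | hu
  · exact dvd_zero g
  obtain ⟨u', g', d, hrel, rfl, rfl⟩ := UniqueFactorizationMonoid.exists_reduced_factors u hu g
  have hd : d ≠ 0 := left_ne_zero_of_mul hu
  have hg' : IsUnit g' := hS g' fun f hf => by
    have h1 : d * g' ∣ d * (f * u') := by
      have := h f hf
      rwa [mul_left_comm] at this
    exact hrel.symm.dvd_of_dvd_mul_right ((mul_dvd_mul_iff_left hd).1 h1)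
  exact mul_dvd_mul_left d (hg'.dvd)

/-- Two linear forms on a module over a factorial domain that have the same kernel, and images
without common factor, have the same image. -/
lemma range_eq_of_ker_eq {R M : Type*} [CommRing R] [IsDomain R] [UniqueFactorizationMonoid R]
    [AddCommGroup M] [Module R M] {φ φ' : M →ₗ[R] R} (hker : ∀ s, φ s = 0 ↔ φ' s = 0)
    (h : ∀ d, (∀ f ∈ LinearMap.range φ, d ∣ f) → IsUnit d)
    (h' : ∀ d, (∀ f ∈ LinearMap.range φ', d ∣ f) → IsUnit d) :
    LinearMap.range φ = LinearMap.range φ' := by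
  -- the two forms are proportional, because `φ t • s - φ s • t` is in the kernel of both
  have cross : ∀ s t, φ t * φ' s = φ s * φ' t := fun s t => by
    have h1 : φ (φ t • s - φ s • t) = 0 := by simp [mul_comm]
    have h2 := (hker _).1 h1
    simpa [sub_eq_zero] using h2
  obtain ⟨t, ht⟩ : ∃ t, φ t ≠ 0 := by
    by_contra! hall
    refine not_isUnit_zero (h 0 ?_)
    rintro f ⟨s, rfl⟩
    simp [hall]
  have d1 : φ t ∣ φ' t := dvd_of_forall_dvd_mul h <| by
    rintro f ⟨s, rfl⟩
    exact ⟨_, (cross s t).symm⟩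
  have d2 : φ' t ∣ φ t := dvd_of_forall_dvd_mul h' <| by
    rintro f ⟨s, rfl⟩
    exact ⟨φ s, by rw [mul_comm, cross s t, mul_comm]⟩
  obtain ⟨u, hu⟩ := associated_of_dvd_dvd d1 d2
  have hs : ∀ s, φ' s = φ s * u := fun s =>
    mul_left_cancel₀ ht (by rw [cross s t, ← hu]; ring)
  apply le_antisymm
  · rintro _ ⟨s, rfl⟩
    refine ⟨(↑u⁻¹ : R) • s, ?_⟩
    rw [map_smul, hs, smul_eq_mul, mul_comm, mul_assoc, Units.mul_inv, mul_one]
  · rintro _ ⟨s, rfl⟩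
    refine ⟨(u : R) • s, ?_⟩
    rw [map_smul, hs, smul_eq_mul, mul_comm]

lemma IsMinimalSyzygy.degree_unique {F : MvPolynomial (Fin 3) k}
    {ε ε' : Fin 3 → MvPolynomial (Fin 3) k} {e e' : ℕ} (h : IsMinimalSyzygy F ε e)
    (h' : IsMinimalSyzygy F ε' e') : e = e' :=
  le_antisymm (h.minimal _ h'.mem h'.ne_zero _ h'.homogeneous)
    (h'.minimal _ h.mem h.ne_zero _ h.homogeneous)

/-- The Bourbaki ideal is determined by the syzygy. -/
lemma IsBourbakiIdeal.unique {F : MvPolynomial (Fin 3) k} {ε : Fin 3 → MvPolynomial (Fin 3) k}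
    {I I' : Ideal (MvPolynomial (Fin 3) k)} (h : IsBourbakiIdeal F ε I)
    (h' : IsBourbakiIdeal F ε I') : I = I' := by
  obtain ⟨e, -, hI, φ, rfl, hφ, -⟩ := h
  obtain ⟨e', -, hI', φ', rfl, hφ', -⟩ := h'
  exact range_eq_of_ker_eq (fun s => (hφ s).trans (hφ' s).symm) hI hI'

/-! ### The curve and its syzygies -/

lemma isHomogeneous_curve (b : ℕ) : (curve k b).IsHomogeneous (2 * b + 2) := by
  have hX := fun i n => isHomogeneous_X_pow (R := k) (i : Fin 3) n
  have h0 := (hX 0 (2 * b + 1)).mul (isHomogeneous_X k (2 : Fin 3))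
  have h1 := (hX 0 (b + 1)).mul (hX 1 (b + 1))
  have h2 := (hX 1 (2 * b + 1)).mul (isHomogeneous_X k (2 : Fin 3))
  rw [show b + 1 + (b + 1) = 2 * b + 2 by ring] at h1
  exact (h0.add h1).add h2

lemma curve_ne_zero (b : ℕ) : curve k b ≠ 0 := by
  intro h
  have := congrArg (eval ![1, 0, 1]) h
  simp [curve] at this

/-- The derivative `x^(2b+1) + y^(2b+1)` of the curve with respect to `z` is prime to `x y`, while
`F - z F_z` divides a power of `x y`; so the curve has no multiple factor. -/
lemma squarefree_curve (b : ℕ) : Squarefree (curve k b) := by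
  rw [squarefree_iff_irreducible_sq_not_dvd_of_ne_zero (curve_ne_zero b)]
  rintro p hp ⟨q, hq⟩
  have hF : p ∣ curve k b := ⟨p * q, by rw [hq, mul_assoc]⟩
  have hz : p ∣ X 0 ^ (2 * b + 1) + X 1 ^ (2 * b + 1) := by
    have e : pderiv 2 (curve k b) = X 0 ^ (2 * b + 1) + X 1 ^ (2 * b + 1) := by
      simp [curve, pderiv_X]
    rw [← e, hq]
    refine ⟨2 * pderiv 2 p * q + p * pderiv 2 q, ?_⟩
    simp only [Derivation.leibniz, smul_eq_mul]
    ring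
  have hxy : p ∣ X 0 ^ (b + 1) * X 1 ^ (b + 1) := by
    have := dvd_sub hF (hz.mul_left (X 2))
    convert this using 1
    rw [curve]
    ring
  refine hp.not_isUnit (IsRelPrime.isUnit_of_dvd (y := X 0 ^ (b + 1) * X 1 ^ (b + 1)) ?_ hxy)
  have hr0 : IsRelPrime (X 0 : MvPolynomial (Fin 3) k)
      (X 0 ^ (2 * b + 1) + X 1 ^ (2 * b + 1)) :=
    isRelPrime_X_of_setZero_ne (by simp [setZero_X_of_ne])
  have hr1 : IsRelPrime (X 1 : MvPolynomial (Fin 3) k)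
      (X 0 ^ (2 * b + 1) + X 1 ^ (2 * b + 1)) :=
    isRelPrime_X_of_setZero_ne (by simp [setZero_X_of_ne])
  exact (hr0.pow_left.mul_left hr1.pow_left).symm.of_dvd_left hz

lemma mem_syz_curve {b : ℕ} {s : Fin 3 → MvPolynomial (Fin 3) k} :
    s ∈ syz (curve k b) ↔
      s 0 * (X 0 ^ b * (C (2 * (b : k) + 1) * X 0 ^ b * X 2
        + C ((b : k) + 1) * X 1 ^ (b + 1)))
      + s 1 * (X 1 ^ b * (C (2 * (b : k) + 1) * X 1 ^ b * X 2
        + C ((b : k) + 1) * X 0 ^ (b + 1)))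
      + s 2 * (X 0 ^ (2 * b + 1) + X 1 ^ (2 * b + 1)) = 0 := by
  have e0 : pderiv 0 (curve k b) = X 0 ^ b * (C (2 * (b : k) + 1) * X 0 ^ b * X 2
        + C ((b : k) + 1) * X 1 ^ (b + 1)) := by
    simp [curve, pderiv_X, show (C 2 : MvPolynomial (Fin 3) k) = 2 from map_ofNat C 2]
    ring
  have e1 : pderiv 1 (curve k b) = X 1 ^ b * (C (2 * (b : k) + 1) * X 1 ^ b * X 2
        + C ((b : k) + 1) * X 0 ^ (b + 1)) := by
    simp [curve, pderiv_X, show (C 2 : MvPolynomial (Fin 3) k) = 2 from map_ofNat C 2]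
    ring
  have e2 : pderiv 2 (curve k b) = X 0 ^ (2 * b + 1) + X 1 ^ (2 * b + 1) := by
    simp [curve, pderiv_X]
  rw [syz, LinearMap.mem_ker, Fintype.linearCombination_apply, Fin.sum_univ_three, e0, e1, e2]
  rfl

lemma exists_isSolution_of_mem_syz {b : ℕ} {s : Fin 3 → MvPolynomial (Fin 3) k}
    (hs : s ∈ syz (curve k b)) :
    ∃ h, IsSolution ((b : k) + 1) (2 * (b : k) + 1) b h (s 0) (s 1) (s 2) := by
  rw [mem_syz_curve] at hs
  generalize (b : k) + 1 = a, 2 * (b : k) + 1 = c at *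
  -- modulo `y ^ b` the equation of the syzygies says `x ^ (2 b) (c z s₀ + x s₂) = 0`
  have hd : X 1 ^ b ∣ X 0 ^ (2 * b) * (C c * X 2 * s 0 + X 0 * s 2) :=
    ⟨-(C a * X 0 ^ b * X 1 * s 0
      + (C c * X 1 ^ b * X 2 + C a * X 0 ^ (b + 1)) * s 1 + X 1 ^ (b + 1) * s 2), by
      linear_combination hs⟩
  have hrel : IsRelPrime (X 1 ^ b) (X 0 ^ (2 * b) : MvPolynomial (Fin 3) k) :=
    (isRelPrime_X_X (by decide)).pow_left.pow_right
  obtain ⟨h, hh⟩ := hrel.dvd_of_dvd_mul_left hd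
  refine ⟨h, hh.symm, mul_left_cancel₀ (pow_ne_zero b (X_ne_zero (R := k) (1 : Fin 3))) ?_⟩
  linear_combination hs - X 0 ^ (2 * b) * hh

lemma mem_syz_of_isSolution {b : ℕ} {h s₀ s₁ s₂ : MvPolynomial (Fin 3) k}
    (H : IsSolution ((b : k) + 1) (2 * (b : k) + 1) b h s₀ s₁ s₂) :
    ![s₀, s₁, s₂] ∈ syz (curve k b) := by
  rw [mem_syz_curve]
  simp only [Matrix.cons_val_zero, Matrix.cons_val_one, Matrix.cons_val]
  obtain ⟨H1, H2⟩ := H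
  linear_combination X 1 ^ b * H2 - X 0 ^ (2 * b) * H1

lemma IsSolution.unique {a c : k} {b : ℕ} {h h' s₀ s₁ s₂ : MvPolynomial (Fin 3) k}
    (H : IsSolution a c b h s₀ s₁ s₂) (H' : IsSolution a c b h' s₀ s₁ s₂) : h = h' :=
  mul_left_cancel₀ (pow_ne_zero b (X_ne_zero (R := k) (1 : Fin 3))) (H.1.trans H'.1.symm)

/-- The map `Syz(J_F) → R` that sends a syzygy `s` to `(c z s₀ + x s₂) / y^b`. -/
noncomputable def curveMap (k : Type*) [Field k] (b : ℕ) :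
    syz (curve k b) →ₗ[MvPolynomial (Fin 3) k] MvPolynomial (Fin 3) k where
  toFun s := (exists_isSolution_of_mem_syz s.2).choose
  map_add' s t := (exists_isSolution_of_mem_syz (s + t).2).choose_spec.unique
    ((exists_isSolution_of_mem_syz s.2).choose_spec.add
      (exists_isSolution_of_mem_syz t.2).choose_spec)
  map_smul' r s := (exists_isSolution_of_mem_syz (r • s).2).choose_spec.unique
    ((exists_isSolution_of_mem_syz s.2).choose_spec.mul r)

lemma isSolution_curveMap {b : ℕ} (s : syz (curve k b)) :
    IsSolution ((b : k) + 1) (2 * (b : k) + 1) b (curveMap k b s) (s.1 0) (s.1 1) (s.1 2) :=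
  (exists_isSolution_of_mem_syz s.2).choose_spec

lemma range_curveMap {b : ℕ} (hb : 1 ≤ b) (ha : (b : k) + 1 ≠ 0) (hc : 2 * (b : k) + 1 ≠ 0)
    (h2 : (2 : k) ≠ 0) :
    LinearMap.range (curveMap k b) = curveIdeal ((b : k) + 1) (2 * (b : k) + 1) b := by
  ext h
  constructor
  · rintro ⟨s, rfl⟩
    exact mem_curveIdeal_of_isSolution ha hc h2 hb (isSolution_curveMap s)
  · intro hh
    obtain ⟨s₀, s₁, s₂, H⟩ := exists_isSolution_of_mem ha hc h2 hb hh
    exact ⟨⟨_, mem_syz_of_isSolution H⟩, (isSolution_curveMap _).unique H⟩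

lemma exists_of_isSolution_zero {a c : k} {b : ℕ} (ha : a ≠ 0) (hc : c ≠ 0) (h2 : (2 : k) ≠ 0)
    {s₀ s₁ s₂ : MvPolynomial (Fin 3) k} (H : IsSolution a c b 0 s₀ s₁ s₂) :
    ∃ r, s₀ = r * (X 0 * (-(C a * X 0 ^ (b + 1)) - C c * (X 1 ^ b * X 2))) ∧
      s₁ = r * (X 1 * (C a * X 0 ^ (b + 1) - C c * (X 1 ^ b * X 2))) ∧
      s₂ = r * (C c * X 2 * (C a * X 0 ^ (b + 1) + C c * (X 1 ^ b * X 2))) := by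
  obtain ⟨H1, H2⟩ := H
  have x0 : (X 0 : MvPolynomial (Fin 3) k) ≠ 0 := X_ne_zero _
  obtain ⟨u, rfl⟩ : X 0 ∣ s₀ := by
    refine (C_mul_dvd_iff hc _ _).1 ((isRelPrime_X_X (show (0 : Fin 3) ≠ 2 by decide)
      ).dvd_of_dvd_mul_left ⟨-s₂, ?_⟩)
    linear_combination -H1
  have hs₂ : s₂ = -(C c * X 2 * u) := mul_left_cancel₀ x0 (by linear_combination -H1)
  subst hs₂
  -- `H` divides `u y (2 a x^(b+1) - H)`, and it is prime to `x` and to `y`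
  have hdvd : C c * X 1 ^ b * X 2 + C a * X 0 ^ (b + 1)
      ∣ X 0 ^ (b + 1) * (X 1 * (C (2 * a) * u)) := by
    refine ⟨X 1 * u - s₁, ?_⟩
    simp only [C_mul, map_ofNat]
    linear_combination H2
  have hr1 : IsRelPrime (X 1)
      (C c * X 1 ^ b * X 2 + C a * X 0 ^ (b + 1) : MvPolynomial (Fin 3) k) := by
    apply isRelPrime_X_of_setZero_ne
    intro h0
    have := congrArg (eval ![1, 0, 0]) h0
    simp [setZero, ha] at this
  have hdu := (C_mul_dvd_iff (by simp [h2, ha] : 2 * a ≠ 0) _ _).1 (hr1.symm.dvd_of_dvd_mul_left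
    ((isRelPrime_X_zero_trinomial a hc).pow_left.symm.dvd_of_dvd_mul_left hdvd))
  obtain ⟨r, rfl⟩ := hdu
  have hH : (C c * X 1 ^ b * X 2 + C a * X 0 ^ (b + 1) : MvPolynomial (Fin 3) k) ≠ 0 := by
    intro h0
    have := congrArg (eval ![1, 0, 0]) h0
    simp [ha] at this
  refine ⟨-r, by ring, mul_left_cancel₀ hH ?_, by ring⟩
  linear_combination H2

lemma isSolution_zero (a c : k) (b : ℕ) :
    IsSolution a c b 0 (X 0 * (-(C a * X 0 ^ (b + 1)) - C c * (X 1 ^ b * X 2)))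
      (X 1 * (C a * X 0 ^ (b + 1) - C c * (X 1 ^ b * X 2)))
      (C c * X 2 * (C a * X 0 ^ (b + 1) + C c * (X 1 ^ b * X 2))) := by
  constructor <;> ring

lemma curveSyzygy_mem (b : ℕ) : curveSyzygy k b ∈ syz (curve k b) :=
  mem_syz_of_isSolution (isSolution_zero _ _ b)

lemma curveMap_eq_zero_iff {b : ℕ} (ha : (b : k) + 1 ≠ 0) (hc : 2 * (b : k) + 1 ≠ 0)
    (h2 : (2 : k) ≠ 0) (s : syz (curve k b)) :
    curveMap k b s = 0 ↔ ∃ r : MvPolynomial (Fin 3) k,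
      (s : Fin 3 → MvPolynomial (Fin 3) k) = r • curveSyzygy k b := by
  constructor
  · intro h
    have H := isSolution_curveMap s
    rw [h] at H
    obtain ⟨r, h0, h1, h2⟩ := exists_of_isSolution_zero ha hc h2 H
    refine ⟨r, ?_⟩
    ext1 i
    fin_cases i
    · exact h0
    · exact h1
    · exact h2
  · rintro ⟨r, hr⟩
    have H := isSolution_curveMap s
    rw [hr] at H
    have H' := (isSolution_zero ((b : k) + 1) (2 * (b : k) + 1) b).mul r
    rw [mul_zero] at H'
    exact H.unique H'

lemma degree_of_mem_support_curveMap {b t : ℕ} (s : syz (curve k b))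
    (hs : IsHomogeneousTriple (s : Fin 3 → MvPolynomial (Fin 3) k) t) {m : Fin 3 →₀ ℕ}
    (hm : m ∈ (curveMap k b s).support) : m.degree + b = t + 1 := by
  have hom : (X 1 ^ b * curveMap k b s).IsHomogeneous (t + 1) := by
    rw [(isSolution_curveMap s).1]
    have h0 := ((isHomogeneous_X k (2 : Fin 3)).C_mul (2 * (b : k) + 1)).mul (hs 0)
    have h2 := (isHomogeneous_X k (0 : Fin 3)).mul (hs 2)
    rw [add_comm 1 t] at h0 h2
    exact h0.add h2
  have hne : coeff (Finsupp.single 1 b + m) (X 1 ^ b * curveMap k b s) ≠ 0 := by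
    rw [X_pow_eq_monomial, coeff_monomial_mul, one_mul]
    exact mem_support_iff.1 hm
  have hd : (Finsupp.single 1 b + m).degree = t + 1 := by
    by_contra h
    exact hne (hom.coeff_eq_zero h)
  rw [map_add, Finsupp.degree_single] at hd
  omega

lemma isHomogeneous_curveSyzygy (b : ℕ) : IsHomogeneousTriple (curveSyzygy k b) (b + 2) := by
  have hX := fun i => isHomogeneous_X k (i : Fin 3)
  have h0 := ((isHomogeneous_X_pow (R := k) (0 : Fin 3) (b + 1))).C_mul ((b : k) + 1)
  have h1 := ((isHomogeneous_X_pow (R := k) (1 : Fin 3) b).mul (hX 2)).C_mul (2 * (b : k) + 1)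
  have e : 1 + (b + 1) = b + 2 := by ring
  intro i
  rw [← e]
  fin_cases i
  · exact (hX 0).mul (h0.neg.sub h1)
  · exact (hX 1).mul (h0.sub h1)
  · exact ((hX 2).C_mul _).mul (h0.add h1)

lemma curveSyzygy_two_ne_zero {b : ℕ} (ha : (b : k) + 1 ≠ 0) (hc : 2 * (b : k) + 1 ≠ 0) :
    curveSyzygy k b 2 ≠ 0 := by
  intro h0
  rcases Nat.eq_zero_or_pos b with rfl | hb
  · have := congrArg (eval ![0, 0, 1]) h0
    simp [curveSyzygy] at this
  · have := congrArg (eval ![1, 0, 1]) h0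
    simp [curveSyzygy, ha, hc, hb.ne'] at this

lemma three_le_degree_of_mem_curveIdeal {a c : k} {b : ℕ} (hb : 2 ≤ b)
    {h : MvPolynomial (Fin 3) k} (hh : h ∈ curveIdeal a c b) {m : Fin 3 →₀ ℕ}
    (hm : m ∈ h.support) : 3 ≤ m.degree := by
  have hle : curveIdeal a c b ≤ idealOfVars (Fin 3) k ^ 3 := by
    have hX : ∀ i, (X i : MvPolynomial (Fin 3) k) ∈ idealOfVars (Fin 3) k := fun i =>
      Ideal.subset_span ⟨i, rfl⟩
    have mul2 : ∀ i j, (X i * X j : MvPolynomial (Fin 3) k) ∈ idealOfVars (Fin 3) k ^ 2 :=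
      fun i j => by rw [pow_two]; exact Ideal.mul_mem_mul (hX i) (hX j)
    have mul3 : ∀ i j l, (X i * X j * X l : MvPolynomial (Fin 3) k)
        ∈ idealOfVars (Fin 3) k ^ 3 :=
      fun i j l => by rw [pow_succ]; exact Ideal.mul_mem_mul (mul2 i j) (hX l)
    obtain ⟨n, rfl⟩ : ∃ n, b = n + 2 := ⟨b - 2, by omega⟩
    rw [curveIdeal, Ideal.span_le]
    rintro _ (rfl | rfl | rfl | rfl) <;> rw [SetLike.mem_coe]
    · have h1 := Ideal.mul_mem_left _ (C a * X 0 ^ n) (mul3 0 0 0)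
      have h2 := Ideal.mul_mem_left _ (C c * X 1 ^ n) (mul3 1 1 2)
      convert Ideal.sub_mem _ h1 h2 using 1
      ring
    · exact mul3 0 1 2
    · convert mul3 0 0 2 using 1
      ring
    · convert mul3 1 2 2 using 1
      ring
  exact (mem_pow_idealOfVars_iff 3 h).1 (hle hh) m hm

lemma isMinimalSyzygy_curveSyzygy {b : ℕ} (hb : 2 ≤ b) (ha : (b : k) + 1 ≠ 0)
    (hc : 2 * (b : k) + 1 ≠ 0) (h2 : (2 : k) ≠ 0) :
    IsMinimalSyzygy (curve k b) (curveSyzygy k b) (b + 2) where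
  mem := curveSyzygy_mem b
  ne_zero h := curveSyzygy_two_ne_zero ha hc (congrFun h 2)
  homogeneous := isHomogeneous_curveSyzygy b
  minimal s hs hs0 t ht := by
    by_cases h : curveMap k b ⟨s, hs⟩ = 0
    · obtain ⟨r, rfl⟩ := (curveMap_eq_zero_iff ha hc h2 _).1 h
      have hr : r ≠ 0 := by
        rintro rfl
        exact hs0 (zero_smul _ _)
      have hne := curveSyzygy_two_ne_zero ha hc
      have d1 := (ht 2).totalDegree (mul_ne_zero hr hne)
      have d2 := (isHomogeneous_curveSyzygy b 2).totalDegree hne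
      rw [Pi.smul_apply, smul_eq_mul, totalDegree_mul_of_isDomain hr hne, d2] at d1
      omega
    · obtain ⟨m, hm⟩ := support_nonempty.2 h
      have d1 := degree_of_mem_support_curveMap ⟨s, hs⟩ ht hm
      have d2 : 3 ≤ m.degree := three_le_degree_of_mem_curveIdeal hb
        (by rw [← range_curveMap (by omega) ha hc h2]; exact ⟨_, rfl⟩) hm
      omega

lemma isUnit_of_forall_dvd_curveIdeal {a c : k} {b : ℕ} (ha : a ≠ 0) (hc : c ≠ 0)
    {g : MvPolynomial (Fin 3) k} (hg : ∀ f ∈ curveIdeal a c b, g ∣ f) : IsUnit g := by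
  have hr : ∀ i : Fin 3, IsRelPrime (X i) (C a * X 0 ^ (b + 1) - C c * X 1 ^ b * X 2) := by
    intro i
    apply isRelPrime_X_of_setZero_ne
    intro h0
    fin_cases i
    · have := congrArg (eval ![0, 1, 1]) h0
      simp [setZero, hc] at this
    · have := congrArg (eval ![1, 0, 0]) h0
      simp [setZero, ha] at this
    · have := congrArg (eval ![1, 0, 0]) h0
      simp [setZero, ha] at this
  exact (((hr 0).mul_left (hr 1)).mul_left (hr 2)) (hg _ (xyz_mem_curveIdeal a c b))
    (hg _ (binomial_mem_curveIdeal a c b))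

lemma isBourbakiIdeal_curveIdeal {b : ℕ} (hb : 2 ≤ b) (ha : (b : k) + 1 ≠ 0)
    (hc : 2 * (b : k) + 1 ≠ 0) (h2 : (2 : k) ≠ 0) :
    IsBourbakiIdeal (curve k b) (curveSyzygy k b)
      (curveIdeal ((b : k) + 1) (2 * (b : k) + 1) b) := by
  refine ⟨b + 2, isMinimalSyzygy_curveSyzygy hb ha hc h2,
    fun g hg => isUnit_of_forall_dvd_curveIdeal ha hc hg, curveMap k b,
    range_curveMap (by omega) ha hc h2, curveMap_eq_zero_iff ha hc h2, ?_⟩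
  intro s t hs m hm
  have d1 := degree_of_mem_support_curveMap s hs hm
  rw [(isHomogeneous_curve b).totalDegree (curve_ne_zero b)]
  omega

/-! ### The Hilbert function of a Bourbaki ideal -/

lemma finrank_map_add_finrank_inf_ker {M N : Type*} [AddCommGroup M] [Module k M]
    [AddCommGroup N] [Module k N] (f : M →ₗ[k] N) (W : Submodule k M) [FiniteDimensional k W] :
    Module.finrank k (W.map f) + Module.finrank k (W ⊓ LinearMap.ker f : Submodule k M)
      = Module.finrank k W := by
  rw [← (f.domRestrict W).finrank_range_add_finrank_ker, LinearMap.range_domRestrict,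
    LinearMap.ker_domRestrict, ← Submodule.map_comap_subtype, Submodule.finrank_map_subtype_eq]

lemma finrank_map_of_injective {M N : Type*} [AddCommGroup M] [Module k M]
    [AddCommGroup N] [Module k N] {f : M →ₗ[k] N} (hf : Function.Injective f)
    (W : Submodule k M) : Module.finrank k (W.map f) = Module.finrank k W :=
  (LinearEquiv.finrank_eq (Submodule.equivMapOfInjective f hf W)).symm

instance finiteDimensional_homogeneousSubmodule (n : ℕ) :
    FiniteDimensional k (homogeneousSubmodule (Fin 3) k n) :=
  Module.Finite.iff_fg.2 (homogeneousSubmodule_fg (Fin 3) k n)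

/-- The Hilbert function of `R/I` and the dimension of the forms of degree `n` in `I`. -/
lemma hilbertFunction_add (I : Ideal (MvPolynomial (Fin 3) k)) (n : ℕ) :
    hilbertFunction I n
      + Module.finrank k (homogeneousSubmodule (Fin 3) k n ⊓ I.restrictScalars k :
        Submodule k (MvPolynomial (Fin 3) k))
      = Module.finrank k (homogeneousSubmodule (Fin 3) k n) := by
  have hker : LinearMap.ker (Ideal.Quotient.mkₐ k I).toLinearMap = I.restrictScalars k := by
    ext f
    simp [Ideal.Quotient.eq_zero_iff_mem]
  rw [hilbertFunction, ← hker, finrank_map_add_finrank_inf_ker]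

lemma weight_one_eq_degree (d : Fin 3 →₀ ℕ) : Finsupp.weight (1 : Fin 3 → ℕ) d = d.degree := by
  rw [Finsupp.degree_eq_weight_one]
  rfl

lemma homogeneousComponent_mul_of_isHomogeneous {q : MvPolynomial (Fin 3) k} {m : ℕ}
    (hq : q.IsHomogeneous m) (p : MvPolynomial (Fin 3) k) (j : ℕ) :
    homogeneousComponent (j + m) (p * q) = homogeneousComponent j p * q := by
  have h1 : ∀ i, homogeneousComponent (j + m) (homogeneousComponent i p * q)
      = if j = i then homogeneousComponent i p * q else 0 := fun i => by
    rw [homogeneousComponent_of_mem ((homogeneousComponent_isHomogeneous i p).mul hq)]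
    simp
  conv_lhs => rw [← sum_homogeneousComponent p, Finset.sum_mul, map_sum]
  simp only [h1, Finset.sum_ite_eq, Finset.mem_range]
  split_ifs with h
  · rfl
  · rw [homogeneousComponent_eq_zero _ _ (by omega), zero_mul]

/-- The homogeneous components of a syzygy of a form are syzygies. -/
lemma homogeneousComponent_mem_syz {F : MvPolynomial (Fin 3) k} {D : ℕ} (hF : F.IsHomogeneous D)
    {s : Fin 3 → MvPolynomial (Fin 3) k} (hs : s ∈ syz F) (j : ℕ) :
    (fun i => homogeneousComponent j (s i)) ∈ syz F := by
  rw [syz, LinearMap.mem_ker, Fintype.linearCombination_apply] at hs ⊢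
  have h := congrArg (homogeneousComponent (j + (D - 1))) hs
  rw [map_sum, map_zero] at h
  rw [← h]
  refine Finset.sum_congr rfl fun i _ => ?_
  rw [smul_eq_mul, smul_eq_mul, homogeneousComponent_mul_of_isHomogeneous hF.pderiv]

/-- The space of homogeneous syzygies of degree `t`. -/
noncomputable def syzHomogeneous (F : MvPolynomial (Fin 3) k) (t : ℕ) :
    Submodule k (syz F) where
  carrier := {s | IsHomogeneousTriple (s : Fin 3 → MvPolynomial (Fin 3) k) t}
  add_mem' hs hs' i := (hs i).add (hs' i)
  zero_mem' _ := isHomogeneous_zero _ _ _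
  smul_mem' r s hs i := by
    change (r • s.1 i).IsHomogeneous t
    rw [smul_eq_C_mul]
    exact (hs i).C_mul r

instance finiteDimensional_syzHomogeneous (F : MvPolynomial (Fin 3) k) (t : ℕ) :
    FiniteDimensional k (syzHomogeneous F t) := by
  let f : syzHomogeneous F t →ₗ[k] (Fin 3 → homogeneousSubmodule (Fin 3) k t) :=
    { toFun := fun s i => ⟨s.1.1 i, s.2 i⟩
      map_add' := fun _ _ => rfl
      map_smul' := fun _ _ => rfl }
  refine Module.Finite.of_injective f fun s s' h => ?_
  ext i : 3
  exact congrArg Subtype.val (congrFun h i)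

/-- The exact sequence of a Bourbaki ideal in large degrees: as `dim R_n - dim (R/I)_n` is
`dim Syz(J_F)_t - dim R_(t-e)`, the Hilbert function of `R/I` depends only on `F` and `e`. -/
lemma IsBourbakiIdeal.hilbertFunction_add_finrank {F : MvPolynomial (Fin 3) k}
    {ε : Fin 3 → MvPolynomial (Fin 3) k} {I : Ideal (MvPolynomial (Fin 3) k)} {e : ℕ}
    (hF : F.IsHomogeneous F.totalDegree) (hI : IsBourbakiIdeal F ε I)
    (hε : IsMinimalSyzygy F ε e) {m n : ℕ} (hn : m + e + e + 1 = n + F.totalDegree) :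
    hilbertFunction I n + Module.finrank k (syzHomogeneous F (m + e))
      = Module.finrank k (homogeneousSubmodule (Fin 3) k n)
        + Module.finrank k (homogeneousSubmodule (Fin 3) k m) := by
  obtain ⟨e', he', -, φ, rfl, hker, hgr⟩ := hI
  obtain rfl := hε.degree_unique he'
  let φk : syz F →ₗ[k] MvPolynomial (Fin 3) k := φ.restrictScalars k
  let g : MvPolynomial (Fin 3) k →ₗ[k] syz F :=
    (LinearMap.toSpanSingleton (MvPolynomial (Fin 3) k) (syz F) ⟨ε, hε.mem⟩).restrictScalars k
  have hφhom : ∀ (s : syz F) (t j : ℕ), t + e + 1 = j + F.totalDegree →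
      IsHomogeneousTriple (s : Fin 3 → MvPolynomial (Fin 3) k) t → (φ s).IsHomogeneous j := by
    intro s t j ht hs d hd
    have := hgr s t hs d (mem_support_iff.2 hd)
    rw [weight_one_eq_degree]
    omega
  obtain ⟨i₀, hi₀⟩ : ∃ i, ε i ≠ 0 := Function.ne_iff.1 hε.ne_zero
  have hg : Function.Injective g := by
    intro r r' h
    have := congrFun (congrArg Subtype.val h) i₀
    exact mul_right_cancel₀ hi₀ this
  have h1 : (syzHomogeneous F (m + e)).map φk
      = homogeneousSubmodule (Fin 3) k n ⊓ (LinearMap.range φ).restrictScalars k := by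
    apply le_antisymm
    · rintro _ ⟨s, hs, rfl⟩
      exact ⟨hφhom s _ n hn hs, ⟨s, rfl⟩⟩
    · rintro _ ⟨hh, ⟨s, rfl⟩⟩
      let comp : ℕ → syz F := fun j =>
        ⟨fun i => homogeneousComponent j (s.1 i), homogeneousComponent_mem_syz hF s.2 j⟩
      have hcomp : ∀ j, IsHomogeneousTriple (comp j).1 j := fun j i =>
        homogeneousComponent_isHomogeneous j _
      refine ⟨comp (m + e), hcomp _, ?_⟩
      -- only the component of degree `m + e` contributes to the degree `n` part of `φ s`
      have hsum : ∃ N, s = ∑ j ∈ Finset.range N, comp j := by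
        refine ⟨∑ i, (s.1 i).totalDegree + 1, ?_⟩
        ext i : 2
        rw [AddSubmonoidClass.coe_finsetSum, Finset.sum_apply]
        conv_lhs => rw [← sum_homogeneousComponent (s.1 i)]
        have hle : (s.1 i).totalDegree ≤ ∑ i, (s.1 i).totalDegree :=
          Finset.single_le_sum (f := fun i => (s.1 i).totalDegree)
            (fun _ _ => Nat.zero_le _) (Finset.mem_univ i)
        refine Finset.sum_subset (Finset.range_mono (by omega)) fun j _ hj => ?_
        rw [Finset.mem_range] at hj
        exact homogeneousComponent_eq_zero _ _ (by omega)
      obtain ⟨N, hN⟩ := hsum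
      have hpart : ∀ j, homogeneousComponent n (φ (comp j))
          = if j = m + e then φ (comp (m + e)) else 0 := by
        intro j
        split_ifs with hj
        · rw [hj]
          exact homogeneousComponent_eq_self (hφhom _ _ n hn (hcomp _))
        · ext d
          rw [coeff_homogeneousComponent, coeff_zero]
          split_ifs with hd
          · by_contra hne
            have := hgr _ _ (hcomp j) d (mem_support_iff.2 hne)
            omega
          · rfl
      have hfin : φ s = ∑ j ∈ Finset.range N, if j = m + e then φ (comp (m + e)) else 0 := by
        rw [← Finset.sum_congr rfl fun j _ => hpart j, ← map_sum, ← map_sum, ← hN]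
        exact (homogeneousComponent_eq_self hh).symm
      change φ (comp (m + e)) = φ s
      rw [hfin, Finset.sum_ite_eq']
      split_ifs with hmem
      · rfl
      · have hzero : comp (m + e) = 0 := by
          ext i : 2
          change homogeneousComponent (m + e) (s.1 i) = 0
          rw [hN, AddSubmonoidClass.coe_finsetSum, Finset.sum_apply, map_sum]
          refine Finset.sum_eq_zero fun j hj => ?_
          rw [homogeneousComponent_of_mem (hcomp j i), if_neg]
          rintro rfl
          exact hmem hj
        rw [hzero, map_zero]
  have h2 : syzHomogeneous F (m + e) ⊓ LinearMap.ker φk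
      = (homogeneousSubmodule (Fin 3) k m).map g := by
    apply le_antisymm
    · rintro s ⟨hs, hs0⟩
      obtain ⟨r, hr⟩ := (hker s).1 hs0
      refine ⟨homogeneousComponent m r, homogeneousComponent_isHomogeneous m r, ?_⟩
      ext i : 2
      change homogeneousComponent m r * ε i = s.1 i
      have hi := homogeneousComponent_eq_self (hs i)
      rwa [hr, Pi.smul_apply, smul_eq_mul,
        homogeneousComponent_mul_of_isHomogeneous (hε.homogeneous i), ← smul_eq_mul r,
        ← Pi.smul_apply, ← hr] at hi
    · rintro _ ⟨r, hr, rfl⟩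
      exact ⟨fun i => IsHomogeneous.mul hr (hε.homogeneous i), (hker _).2 ⟨r, rfl⟩⟩
  have d1 := finrank_map_add_finrank_inf_ker φk (syzHomogeneous F (m + e))
  rw [h1, h2, finrank_map_of_injective hg] at d1
  have d2 := hilbertFunction_add (LinearMap.range φ) n
  omega

lemma IsBourbakiIdeal.eventually_hilbertFunction_eq {F : MvPolynomial (Fin 3) k}
    {ε ε' : Fin 3 → MvPolynomial (Fin 3) k} {I I' : Ideal (MvPolynomial (Fin 3) k)}
    (hF : F.IsHomogeneous F.totalDegree) (hI : IsBourbakiIdeal F ε I)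
    (hI' : IsBourbakiIdeal F ε' I') :
    ∀ᶠ n in Filter.atTop, hilbertFunction I n = hilbertFunction I' n := by
  obtain ⟨e, hε, -⟩ := id hI
  obtain ⟨e', hε', -⟩ := id hI'
  obtain rfl := hε.degree_unique hε'
  filter_upwards [Filter.eventually_ge_atTop (2 * e + 1)] with n hn
  obtain ⟨m, hm⟩ : ∃ m, m + e + e + 1 = n + F.totalDegree :=
    ⟨n + F.totalDegree - (2 * e + 1), by omega⟩
  have h1 := hI.hilbertFunction_add_finrank hF hε hm
  have h2 := hI'.hilbertFunction_add_finrank hF hε' hm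
  omega

/-! ### The degree of the Bourbaki ideal of the curve -/

/-- The ring map `f(x, y, z) ↦ f(u, 1, r u^(b+1))`: the restriction to the branch `z = r x^(b+1)`
through the point `(0 : 1 : 0)` in the chart `y = 1`. -/
noncomputable def branchY (r : k) (b : ℕ) : MvPolynomial (Fin 3) k →ₐ[k] Polynomial k :=
  aeval ![Polynomial.X, 1, Polynomial.C r * Polynomial.X ^ (b + 1)]

/-- The ring map `f(x, y, z) ↦ f(v, 0, 1)`: the restriction to the line `y = 0` in the chart
`z = 1`. -/
noncomputable def branchZ (k : Type*) [Field k] : MvPolynomial (Fin 3) k →ₐ[k] Polynomial k :=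
  aeval ![Polynomial.X, 0, 1]

/-- The Taylor coefficients of order less than `b + 2` along `branchY`, and of order less than `2`
along `branchZ`. On forms of large degree these are the conditions that cut out
`curveIdeal a c b`, if `r = a / c`. -/
noncomputable def taylorMap (r : k) (b : ℕ) :
    MvPolynomial (Fin 3) k →ₗ[k] (Fin (b + 2) → k) × (Fin 2 → k) :=
  LinearMap.prod
    (LinearMap.pi fun i => Polynomial.lcoeff k i ∘ₗ (branchY r b).toLinearMap)
    (LinearMap.pi fun i => Polynomial.lcoeff k i ∘ₗ (branchZ k).toLinearMap)

lemma taylorMap_eq_zero_iff {r : k} {b : ℕ} {f : MvPolynomial (Fin 3) k} :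
    taylorMap r b f = 0 ↔
      Polynomial.X ^ (b + 2) ∣ branchY r b f ∧ Polynomial.X ^ 2 ∣ branchZ k f := by
  rw [Polynomial.X_pow_dvd_iff, Polynomial.X_pow_dvd_iff, Prod.ext_iff, funext_iff, funext_iff,
    Fin.forall_iff, Fin.forall_iff]
  rfl

lemma X_pow_dvd_branchY_of_mem {a c : k} (hc : c ≠ 0) {b : ℕ} (hb : 1 ≤ b)
    {f : MvPolynomial (Fin 3) k} (hf : f ∈ curveIdeal a c b) :
    Polynomial.X ^ (b + 2) ∣ branchY (a / c) b f := by
  have hcr : Polynomial.C c * Polynomial.C (a / c) = Polynomial.C a := by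
    rw [← Polynomial.C_mul, mul_div_cancel₀ a hc]
  have hX : branchY (a / c) b (X 0) = Polynomial.X := by simp [branchY]
  have hY : branchY (a / c) b (X 1) = 1 := by simp [branchY]
  have hZ : branchY (a / c) b (X 2) = Polynomial.C (a / c) * Polynomial.X ^ (b + 1) := by
    simp [branchY]
  have hC : ∀ r : k, branchY (a / c) b (C r) = Polynomial.C r := fun r => by
    simp [branchY]
  generalize branchY (a / c) b = ψ at *
  obtain ⟨n, rfl⟩ : ∃ n, b = n + 1 := ⟨b - 1, by omega⟩
  suffices hle : curveIdeal a c (n + 1) ≤ (Ideal.span {Polynomial.X ^ (n + 1 + 2)}).comap ψ from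
    Ideal.mem_span_singleton.1 (Ideal.mem_comap.1 (hle hf))
  rw [curveIdeal, Ideal.span_le]
  rintro _ (rfl | rfl | rfl | rfl) <;>
    rw [SetLike.mem_coe, Ideal.mem_comap, Ideal.mem_span_singleton] <;>
    simp only [map_sub, map_mul, map_pow, hX, hY, hZ, hC]
  · refine ⟨0, ?_⟩
    linear_combination (-Polynomial.X ^ (n + 2)) * hcr
  · exact ⟨Polynomial.C (a / c), by ring⟩
  · exact ⟨Polynomial.C (a / c) * Polynomial.X, by ring⟩
  · exact ⟨Polynomial.C (a / c) ^ 2 * Polynomial.X ^ (n + 1), by ring⟩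

lemma X_pow_dvd_branchZ_of_mem {a c : k} {b : ℕ} (hb : 1 ≤ b)
    {f : MvPolynomial (Fin 3) k} (hf : f ∈ curveIdeal a c b) :
    Polynomial.X ^ 2 ∣ branchZ k f := by
  have hX : branchZ k (X 0) = Polynomial.X := by simp [branchZ]
  have hY : branchZ k (X 1) = 0 := by simp [branchZ]
  have hZ : branchZ k (X 2) = 1 := by simp [branchZ]
  have hC : ∀ r : k, branchZ k (C r) = Polynomial.C r := fun r => by simp [branchZ]
  generalize branchZ k = ψ at *
  obtain ⟨n, rfl⟩ : ∃ n, b = n + 1 := ⟨b - 1, by omega⟩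
  suffices hle : curveIdeal a c (n + 1) ≤ (Ideal.span {Polynomial.X ^ 2}).comap ψ from
    Ideal.mem_span_singleton.1 (Ideal.mem_comap.1 (hle hf))
  rw [curveIdeal, Ideal.span_le]
  rintro _ (rfl | rfl | rfl | rfl) <;>
    rw [SetLike.mem_coe, Ideal.mem_comap, Ideal.mem_span_singleton] <;>
    simp only [map_sub, map_mul, map_pow, hX, hY, hZ, hC]
  · exact ⟨Polynomial.C a * Polynomial.X ^ n, by ring⟩
  · exact ⟨0, by ring⟩
  · exact ⟨1, by ring⟩
  · exact ⟨0, by ring⟩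

lemma taylorMap_eq_zero_of_mem {a c : k} (hc : c ≠ 0) {b : ℕ} (hb : 1 ≤ b)
    {f : MvPolynomial (Fin 3) k} (hf : f ∈ curveIdeal a c b) : taylorMap (a / c) b f = 0 :=
  taylorMap_eq_zero_iff.2 ⟨X_pow_dvd_branchY_of_mem hc hb hf, X_pow_dvd_branchZ_of_mem hb hf⟩

/-- The combinations of `x^i y^(n-i)`, `i < b + 2`, and `x^i z^(n-i)`, `i < 2`. -/
noncomputable def standardForms (k : Type*) [Field k] (b n : ℕ) :
    ((Fin (b + 2) → k) × (Fin 2 → k)) →ₗ[k] MvPolynomial (Fin 3) k :=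
  LinearMap.coprod
    (Fintype.linearCombination k fun i : Fin (b + 2) => X 0 ^ (i : ℕ) * X 1 ^ (n - (i : ℕ)))
    (Fintype.linearCombination k fun i : Fin 2 => X 0 ^ (i : ℕ) * X 2 ^ (n - (i : ℕ)))

lemma standardForms_apply (b n : ℕ) (p : (Fin (b + 2) → k) × (Fin 2 → k)) :
    standardForms k b n p = ∑ i : Fin (b + 2), p.1 i • (X 0 ^ (i : ℕ) * X 1 ^ (n - (i : ℕ)))
      + ∑ i : Fin 2, p.2 i • (X 0 ^ (i : ℕ) * X 2 ^ (n - (i : ℕ))) := by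
  rw [standardForms, LinearMap.coprod_apply, Fintype.linearCombination_apply,
    Fintype.linearCombination_apply]

lemma isHomogeneous_standardForms {b n : ℕ} (hn : b + 2 ≤ n)
    (p : (Fin (b + 2) → k) × (Fin 2 → k)) : (standardForms k b n p).IsHomogeneous n := by
  have key : ∀ (j : Fin 3) (i : ℕ) (r : k), i ≤ n →
      (r • (X 0 ^ i * X j ^ (n - i)) : MvPolynomial (Fin 3) k).IsHomogeneous n := by
    intro j i r hi
    rw [smul_eq_C_mul]
    have := ((isHomogeneous_X_pow (R := k) (0 : Fin 3) i).mul
      (isHomogeneous_X_pow j (n - i))).C_mul r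
    rwa [Nat.add_sub_cancel' hi] at this
  rw [standardForms_apply]
  refine IsHomogeneous.add ?_ ?_
  · exact IsHomogeneous.sum _ _ _ fun i _ => key 1 i _ (by have := i.2; omega)
  · exact IsHomogeneous.sum _ _ _ fun i _ => key 2 i _ (by have := i.2; omega)

lemma taylorMap_standardForms (r : k) {b n : ℕ} (hb : 1 ≤ b) (hn : b + 2 ≤ n)
    (p : (Fin (b + 2) → k) × (Fin 2 → k)) : taylorMap r b (standardForms k b n p) = p := by
  have hY : branchY r b (standardForms k b n p)
      = ∑ i : Fin (b + 2), p.1 i • Polynomial.X ^ (i : ℕ)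
        + ∑ i : Fin 2, p.2 i • (Polynomial.X ^ (i : ℕ)
          * (Polynomial.C r * Polynomial.X ^ (b + 1)) ^ (n - (i : ℕ))) := by
    simp [standardForms_apply, branchY]
  have hZ : branchZ k (standardForms k b n p)
      = ∑ i : Fin 2, p.2 i • Polynomial.X ^ (i : ℕ) := by
    rw [standardForms_apply, map_add, map_sum, Finset.sum_eq_zero, zero_add]
    · simp [branchZ]
    · intro i _
      have : n - (i : ℕ) ≠ 0 := by omega
      simp [branchZ, this]
  refine Prod.ext (funext fun j => ?_) (funext fun j => ?_)
  · change (branchY r b (standardForms k b n p)).coeff j = p.1 j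
    rw [hY, Polynomial.coeff_add, Polynomial.finsetSum_coeff, Polynomial.finsetSum_coeff,
      Finset.sum_eq_single j, Finset.sum_eq_zero, add_zero]
    · simp
    · intro i _
      -- as `n ≥ 3`, the forms `x z^(n-1)` and `z^n` vanish to order `b + 2` along the branch
      obtain ⟨q, hq⟩ : Polynomial.X ^ (b + 2) ∣ (Polynomial.X ^ (i : ℕ)
          * (Polynomial.C r * Polynomial.X ^ (b + 1)) ^ (n - (i : ℕ)) : Polynomial k) := by
        obtain ⟨l, hl⟩ : ∃ l, n - (i : ℕ) = l + 2 := ⟨n - i - 2, by omega⟩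
        rw [hl]
        exact ⟨Polynomial.X ^ (i : ℕ) * Polynomial.C r ^ 2 * Polynomial.X ^ b
          * (Polynomial.C r * Polynomial.X ^ (b + 1)) ^ l, by ring⟩
      rw [hq, Polynomial.coeff_smul, mul_comm, Polynomial.coeff_mul_X_pow',
        if_neg (show ¬ b + 2 ≤ (j : ℕ) by have := j.2; omega),
        smul_zero]
    · intro i _ hij
      have : (j : ℕ) ≠ i := fun h => hij (Fin.ext h.symm)
      simp [Polynomial.coeff_X_pow, this]
    · simp
  · change (branchZ k (standardForms k b n p)).coeff j = p.2 j
    rw [hZ, Polynomial.finsetSum_coeff, Finset.sum_eq_single j]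
    · simp
    · intro i _ hij
      have : (j : ℕ) ≠ i := fun h => hij (Fin.ext h.symm)
      simp [Polynomial.coeff_X_pow, this]
    · simp

lemma X_zero_pow_mem_curveIdeal {a : k} (ha : a ≠ 0) (c : k) {b : ℕ} (hb : 1 ≤ b) :
    X 0 ^ (b + 2) ∈ curveIdeal a c b := by
  obtain ⟨l, rfl⟩ : ∃ l, b = l + 1 := ⟨b - 1, by omega⟩
  have h1 := Ideal.mul_mem_left _ (C a⁻¹ * X 0) (binomial_mem_curveIdeal a c (l + 1))
  have h2 := Ideal.mul_mem_left _ (C a⁻¹ * C c * X 1 ^ l) (xyz_mem_curveIdeal a c (l + 1))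
  have h3 := Ideal.add_mem _ h1 h2
  convert h3 using 1
  linear_combination (-X 0 ^ (l + 3)) * C_mul_C_inv ha

/-- Modulo `curveIdeal a c b` every form of degree `n ≥ b + 2` is a combination of the standard
ones. -/
lemma homogeneousSubmodule_le_sup {a c : k} (ha : a ≠ 0) (hc : c ≠ 0) {b n : ℕ} (hb : 1 ≤ b)
    (hn : b + 2 ≤ n) :
    homogeneousSubmodule (Fin 3) k n
      ≤ (curveIdeal a c b).restrictScalars k ⊔ LinearMap.range (standardForms k b n) := by
  set W := (curveIdeal a c b).restrictScalars k ⊔ LinearMap.range (standardForms k b n)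
  have inI : ∀ f ∈ curveIdeal a c b, f ∈ W := fun f hf => Submodule.mem_sup_left hf
  have inY : ∀ i, i < b + 2 → X 0 ^ i * X 1 ^ (n - i) ∈ W := fun i hi => by
    refine Submodule.mem_sup_right ⟨(Pi.single ⟨i, hi⟩ 1, 0), ?_⟩
    rw [standardForms_apply, Finset.sum_eq_single ⟨i, hi⟩]
    · simp
    · intro j _ hj
      simp [Pi.single_eq_of_ne hj]
    · simp
  have inZ : ∀ i, i < 2 → X 0 ^ i * X 2 ^ (n - i) ∈ W := fun i hi => by
    refine Submodule.mem_sup_right ⟨(0, Pi.single ⟨i, hi⟩ 1), ?_⟩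
    rw [standardForms_apply, Finset.sum_eq_single (⟨i, hi⟩ : Fin 2)]
    · simp
    · intro j _ hj
      simp [Pi.single_eq_of_ne hj]
    · simp
  have key : ∀ i j l : ℕ, i + j + l = n → X 0 ^ i * X 1 ^ j * X 2 ^ l ∈ W := by
    intro i j l h
    rcases Nat.eq_zero_or_pos l with rfl | hl
    · rw [pow_zero, mul_one]
      rcases lt_or_ge i (b + 2) with hi | hi
      · have := inY i hi
        rwa [show n - i = j by omega] at this
      · refine inI _ (Ideal.mul_mem_right _ _ ?_)
        rw [← Nat.sub_add_cancel hi, pow_add]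
        exact Ideal.mul_mem_left _ _ (X_zero_pow_mem_curveIdeal ha c hb)
    obtain ⟨l, rfl⟩ : ∃ l', l = l' + 1 := ⟨l - 1, by omega⟩
    rcases Nat.lt_or_ge i 2 with hi | hi
    swap
    · obtain ⟨i, rfl⟩ : ∃ i', i = i' + 2 := ⟨i - 2, by omega⟩
      have := Ideal.mul_mem_left _ (X 0 ^ i * X 1 ^ j * X 2 ^ l) (xxz_mem_curveIdeal a c b)
      refine inI _ ?_
      convert this using 1
      ring
    rcases Nat.eq_zero_or_pos j with rfl | hj
    · have := inZ i hi
      rwa [show n - i = l + 1 by omega, ← mul_one (X 0 ^ i), ← pow_zero (X 1)] at this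
    obtain ⟨j, rfl⟩ : ∃ j', j = j' + 1 := ⟨j - 1, by omega⟩
    rcases Nat.eq_zero_or_pos i with rfl | hi'
    swap
    · obtain ⟨i, rfl⟩ : ∃ i', i = i' + 1 := ⟨i - 1, by omega⟩
      have := Ideal.mul_mem_left _ (X 0 ^ i * X 1 ^ j * X 2 ^ l) (xyz_mem_curveIdeal a c b)
      refine inI _ ?_
      convert this using 1
      ring
    rcases Nat.eq_zero_or_pos l with rfl | hl'
    swap
    · obtain ⟨l, rfl⟩ : ∃ l', l = l' + 1 := ⟨l - 1, by omega⟩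
      have := Ideal.mul_mem_left _ (X 1 ^ j * X 2 ^ l) (yzz_mem_curveIdeal a c b)
      refine inI _ ?_
      convert this using 1
      ring
    -- the remaining monomial `y^(n-1) z` is congruent to `(a / c) x^(b+1) y^(n-b-1)`
    obtain ⟨q, rfl⟩ : ∃ q, j = b + q := ⟨j - b, by omega⟩
    have h1 := inI _ (Ideal.mul_mem_left _ (-C c⁻¹ * X 1 ^ (q + 1))
      (binomial_mem_curveIdeal a c b))
    have h2 := W.smul_mem (c⁻¹ * a) (inY (b + 1) (by omega))
    rw [show n - (b + 1) = q + 1 by omega, smul_eq_C_mul, C_mul] at h2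
    have h3 := W.add_mem h1 h2
    convert h3 using 1
    linear_combination (-X 1 ^ (b + q + 1) * X 2) * C_mul_C_inv hc
  intro f hf
  rw [f.as_sum]
  refine Submodule.sum_mem _ fun d hd => ?_
  have hdeg : d 0 + d 1 + d 2 = n := by
    have := hf (mem_support_iff.1 hd)
    rwa [weight_one_eq_degree, Finsupp.degree_eq_sum, Fin.sum_univ_three] at this
  have hm := W.smul_mem (coeff d f) (key _ _ _ hdeg)
  rwa [smul_eq_C_mul, ← Fin.prod_univ_three (fun i => (X i : MvPolynomial (Fin 3) k) ^ d i),
    ← Finsupp.prod_fintype d (fun i m => (X i : MvPolynomial (Fin 3) k) ^ m)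
      (fun i => pow_zero _), ← monomial_eq] at hm

lemma hilbertFunction_curveIdeal {a c : k} (ha : a ≠ 0) (hc : c ≠ 0) {b n : ℕ} (hb : 1 ≤ b)
    (hn : b + 2 ≤ n) : hilbertFunction (curveIdeal a c b) n = b + 4 := by
  have h1 : homogeneousSubmodule (Fin 3) k n ⊓ (curveIdeal a c b).restrictScalars k
      = homogeneousSubmodule (Fin 3) k n ⊓ LinearMap.ker (taylorMap (a / c) b) := by
    apply le_antisymm
    · rintro f ⟨hf, hI⟩
      exact ⟨hf, taylorMap_eq_zero_of_mem hc hb hI⟩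
    · rintro f ⟨hf, hker⟩
      refine ⟨hf, ?_⟩
      obtain ⟨g, hg, _, ⟨p, rfl⟩, rfl⟩ :=
        Submodule.mem_sup.1 (homogeneousSubmodule_le_sup ha hc hb hn hf)
      have hp : p = 0 := by
        rw [SetLike.mem_coe, LinearMap.mem_ker, map_add, taylorMap_eq_zero_of_mem hc hb hg,
          zero_add, taylorMap_standardForms _ hb hn] at hker
        exact hker
      rw [hp, map_zero, add_zero]
      exact hg
  have h2 : (homogeneousSubmodule (Fin 3) k n).map (taylorMap (a / c) b) = ⊤ :=
    eq_top_iff.2 fun p _ => ⟨_, isHomogeneous_standardForms hn p, taylorMap_standardForms _ hb hn p⟩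
  have d1 := hilbertFunction_add (curveIdeal a c b) n
  have d2 := finrank_map_add_finrank_inf_ker (taylorMap (a / c) b)
    (homogeneousSubmodule (Fin 3) k n)
  rw [h2, finrank_top, Module.finrank_prod, Module.finrank_fin_fun, Module.finrank_fin_fun] at d2
  rw [h1] at d1
  omega

lemma hasDegree_of_eventually_eq {I : Ideal (MvPolynomial (Fin 3) k)} {δ : ℕ}
    (h : ∀ᶠ n in Filter.atTop, hilbertFunction I n = δ) : HasDegree I δ := by
  refine ⟨Polynomial.C (δ : ℚ), ?_, by
    rw [Polynomial.leadingCoeff_C, Polynomial.natDegree_C, Nat.factorial_zero, Nat.cast_one,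
      mul_one]⟩
  filter_upwards [h] with n hn
  rw [hn, Polynomial.eval_C]

lemma hasBourbakiDegree_curve {b : ℕ} (hb : 2 ≤ b) (ha : (b : k) + 1 ≠ 0)
    (hc : 2 * (b : k) + 1 ≠ 0) (h2 : (2 : k) ≠ 0) :
    HasBourbakiDegree (curve k b) (b + 4) := by
  have hI₀ := isBourbakiIdeal_curveIdeal hb ha hc h2
  refine ⟨⟨_, _, hI₀⟩, fun ε I hI => hasDegree_of_eventually_eq ?_⟩
  have hF : (curve k b).IsHomogeneous (curve k b).totalDegree := by
    rw [(isHomogeneous_curve b).totalDegree (curve_ne_zero b)]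
    exact isHomogeneous_curve b
  filter_upwards [hI.eventually_hilbertFunction_eq hF hI₀, Filter.eventually_ge_atTop (b + 2)]
    with n h1 h2
  rw [h1, hilbertFunction_curveIdeal ha hc (by omega) h2]

/-! ### The zeros of the Bourbaki ideal -/

lemma forall_eval_curveIdeal_eq_zero_iff {a c : k} (ha : a ≠ 0) {b : ℕ} (hb : 1 ≤ b)
    {v : Fin 3 → k} :
    (∀ f ∈ curveIdeal a c b, eval v f = 0) ↔ v 0 = 0 ∧ (v 2 = 0 ∨ v 1 = 0) := by
  have hb0 : b ≠ 0 := by omega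
  constructor
  · intro h
    have h1 := h _ (binomial_mem_curveIdeal a c b)
    have h2 := h _ (xxz_mem_curveIdeal a c b)
    have h3 := h _ (yzz_mem_curveIdeal a c b)
    simp only [map_sub, map_mul, map_pow, eval_X, eval_C] at h1 h2 h3
    by_cases hz : v 2 = 0
    · simp only [hz, mul_zero, sub_zero, mul_eq_zero, ha, false_or] at h1
      exact ⟨eq_zero_of_pow_eq_zero h1, Or.inl hz⟩
    · simp only [mul_eq_zero, hz, or_false, pow_eq_zero_iff two_ne_zero] at h2 h3
      exact ⟨h2, Or.inr h3⟩
  · rintro ⟨h0, h12⟩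
    suffices hle : curveIdeal a c b ≤ RingHom.ker (eval v) from fun f hf => hle hf
    rw [curveIdeal, Ideal.span_le]
    rcases h12 with h | h <;> rintro _ (rfl | rfl | rfl | rfl) <;>
      simp [RingHom.mem_ker, h0, h, hb0]

lemma mk_eq_pointY_iff {v : Fin 3 → k} (hv : v ≠ 0) :
    Projectivization.mk k v hv = pointY k ↔ v 0 = 0 ∧ v 2 = 0 := by
  rw [pointY, Projectivization.mk_eq_mk_iff']
  constructor
  · rintro ⟨r, rfl⟩
    simp
  · rintro ⟨h0, h2⟩
    refine ⟨v 1, ?_⟩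
    ext i
    fin_cases i <;> simp [h0, h2]

lemma mk_eq_pointZ_iff {v : Fin 3 → k} (hv : v ≠ 0) :
    Projectivization.mk k v hv = pointZ k ↔ v 0 = 0 ∧ v 1 = 0 := by
  rw [pointZ, Projectivization.mk_eq_mk_iff']
  constructor
  · rintro ⟨r, rfl⟩
    simp
  · rintro ⟨h0, h1⟩
    refine ⟨v 2, ?_⟩
    ext i
    fin_cases i <;> simp [h0, h1]

lemma zeros_curveIdeal {a c : k} (ha : a ≠ 0) {b : ℕ} (hb : 1 ≤ b) :
    zeros (curveIdeal a c b) = {pointY k, pointZ k} := by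
  ext P
  rw [zeros, Set.mem_ofPred_eq, Set.mem_insert_iff, Set.mem_singleton_iff]
  constructor
  · intro h
    have h1 := (forall_eval_curveIdeal_eq_zero_iff ha hb).1
      (h P.rep P.rep_nonzero P.mk_rep)
    rw [← P.mk_rep, mk_eq_pointY_iff, mk_eq_pointZ_iff, ← and_or_left]
    exact h1
  · rintro h v hv rfl
    rw [mk_eq_pointY_iff, mk_eq_pointZ_iff, ← and_or_left] at h
    exact (forall_eval_curveIdeal_eq_zero_iff ha hb).2 h

lemma pointY_ne_pointZ : pointY k ≠ pointZ k := by
  intro h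
  have := ((mk_eq_pointZ_iff _).1 h).2
  simp at this

/-! ### The local degrees -/

section LocalRing

variable {σ : Type*} {J : Ideal (MvPolynomial σ k)} {N : ℕ} {l : σ} {q : σ → Polynomial k}

/-- If `J` contains `x_l ^ N` and the equations `x_j = q_j(x_l)` of a curve, and its elements
vanish to order `N` along that curve, then `k[x] / J` is `k[u] / (u ^ N)`. -/
lemma finrank_quotient_eq (hl : q l = Polynomial.X)
    (hX : ∀ j, X j - Polynomial.aeval (X l) (q j) ∈ J) (hN : X l ^ N ∈ J)
    (hJ : ∀ f ∈ J, Polynomial.X ^ N ∣ aeval q f) :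
    Module.finrank k (MvPolynomial σ k ⧸ J) = N := by
  let π : MvPolynomial σ k →ₐ[k] (Polynomial k ⧸ Ideal.span {(Polynomial.X : Polynomial k) ^ N}) :=
    (Ideal.Quotient.mkₐ k _).comp (aeval q)
  have hsurj : Function.Surjective π := by
    refine (Ideal.Quotient.mkₐ_surjective k _).comp fun g => ⟨Polynomial.aeval (X l) g, ?_⟩
    have := Polynomial.aeval_algHom_apply (aeval q : MvPolynomial σ k →ₐ[k] _) (X l) g
    rw [aeval_X, hl, Polynomial.aeval_X_left_apply] at this
    exact this.symm
  have hred : ∀ f, f - Polynomial.aeval (X l) (aeval q f) ∈ J := by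
    intro f
    rw [← Ideal.Quotient.eq]
    have : Ideal.Quotient.mkₐ k J
        = (Ideal.Quotient.mkₐ k J).comp ((Polynomial.aeval (X l)).comp (aeval q)) := by
      refine algHom_ext fun j => ?_
      simpa using Ideal.Quotient.eq.2 (hX j)
    exact DFunLike.congr_fun this f
  have hker : J = RingHom.ker π := by
    ext f
    rw [RingHom.mem_ker]
    change f ∈ J ↔ Ideal.Quotient.mk _ (aeval q f) = 0
    rw [Ideal.Quotient.eq_zero_iff_mem, Ideal.mem_span_singleton]
    refine ⟨hJ f, fun ⟨g, hg⟩ => ?_⟩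
    have h1 := hred f
    rw [hg, map_mul, map_pow, Polynomial.aeval_X] at h1
    exact (Submodule.sub_mem_iff_left _ (Ideal.mul_mem_right _ _ hN)).1 h1
  rw [((Ideal.quotientEquivAlgOfEq k hker).trans
      (Ideal.quotientKerAlgEquivOfSurjective hsurj)).toLinearEquiv.finrank_eq,
    finrank_quotient_span_eq_natDegree, Polynomial.natDegree_X_pow]

/-- If moreover the curve passes through the origin, then `k[x] / J` is already local, and it is
its own localization at the origin. -/
lemma finrank_localization_eq (hl : q l = Polynomial.X) (hq : ∀ j, Polynomial.X ∣ q j)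
    (hX : ∀ j, X j - Polynomial.aeval (X l) (q j) ∈ J) (hN : X l ^ N ∈ J)
    (hJ : ∀ f ∈ J, Polynomial.X ^ N ∣ aeval q f) {p : σ → k} (hp : p = 0) :
    Module.finrank k (Localization ((pointIdeal p).primeCompl.map (Ideal.Quotient.mk J))) = N := by
  subst hp
  have hnil : pointIdeal (0 : σ → k) ≤ (nilradical (MvPolynomial σ k ⧸ J)).comap
      (Ideal.Quotient.mk J) := by
    rw [pointIdeal, Ideal.span_le]
    rintro _ ⟨j, rfl⟩
    rw [SetLike.mem_coe, Ideal.mem_comap, mem_nilradical]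
    simp only [Pi.zero_apply, C_0, sub_zero]
    obtain ⟨g, hg⟩ := hq j
    refine ⟨N, ?_⟩
    rw [Ideal.Quotient.eq.2 (hX j), hg, map_mul, Polynomial.aeval_X, ← map_pow, mul_pow,
      Ideal.Quotient.eq_zero_iff_mem]
    exact Ideal.mul_mem_right _ _ hN
  have hunit : (pointIdeal (0 : σ → k)).primeCompl.map (Ideal.Quotient.mk J)
      ≤ IsUnit.submonoid (MvPolynomial σ k ⧸ J) := by
    rintro _ ⟨f, hf, rfl⟩
    have hf0 : eval (0 : σ → k) f ≠ 0 := by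
      intro h0
      refine hf ?_
      rw [SetLike.mem_coe, pointIdeal_eq_ker]
      exact h0
    have hd : f - C (eval 0 f) ∈ pointIdeal (0 : σ → k) := by
      rw [pointIdeal_eq_ker, RingHom.mem_ker]
      simp
    have hC : IsUnit (Ideal.Quotient.mk J (C (eval 0 f))) :=
      ((IsUnit.mk0 _ hf0).map C).map (Ideal.Quotient.mk J)
    have := IsNilpotent.isUnit_add_left_of_commute (mem_nilradical.1 (hnil hd)) hC
      (Commute.all _ _)
    rw [← map_add, add_sub_cancel] at this
    exact this
  rw [← ((IsLocalization.atUnits (MvPolynomial σ k ⧸ J) _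
      (S := Localization ((pointIdeal (0 : σ → k)).primeCompl.map (Ideal.Quotient.mk J)))
      hunit).restrictScalars k).toLinearEquiv.finrank_eq]
  exact finrank_quotient_eq hl hX hN hJ

end LocalRing

lemma dehomogenize_X_self (i : Fin 3) : dehomogenize i (X i : MvPolynomial (Fin 3) k) = 1 := by
  simp [dehomogenize]

lemma dehomogenize_X_of_ne {i j : Fin 3} (h : j ≠ i) :
    dehomogenize i (X j : MvPolynomial (Fin 3) k) = X ⟨j, h⟩ := by
  simp [dehomogenize, h]

lemma dehomogenize_C (i : Fin 3) (r : k) :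
    dehomogenize i (C r : MvPolynomial (Fin 3) k) = C r := by
  simp [dehomogenize, algebraMap_eq]

lemma hasLocalDegree_pointY {a c : k} (ha : a ≠ 0) (hc : c ≠ 0) {b : ℕ} (hb : 1 ≤ b) :
    HasLocalDegree (curveIdeal a c b) (pointY k) (b + 2) := by
  intro v hv hP i hi
  obtain ⟨h0, h2⟩ := (mk_eq_pointY_iff hv).1 hP
  obtain rfl : i = 1 := by
    fin_cases i
    · exact absurd h0 hi
    · rfl
    · exact absurd h2 hi
  have n0 : (0 : Fin 3) ≠ 1 := by decide
  have n2 : (2 : Fin 3) ≠ 1 := by decide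
  have mem : ∀ {f}, f ∈ curveIdeal a c b →
      dehomogenize 1 f ∈ (curveIdeal a c b).map (dehomogenize 1) := fun hf =>
    Ideal.mem_map_of_mem _ hf
  let q : {j : Fin 3 // j ≠ 1} → Polynomial k := fun j =>
    if j.1 = 0 then Polynomial.X else Polynomial.C (a / c) * Polynomial.X ^ (b + 1)
  have hbranch : (aeval q).comp (dehomogenize 1) = branchY (a / c) b := by
    refine algHom_ext fun j => ?_
    fin_cases j
    · simp [dehomogenize, branchY, q]
    · simp [dehomogenize, branchY]
    · simp [dehomogenize, branchY, q]
  refine finrank_localization_eq (l := ⟨0, n0⟩) (q := q) rfl ?_ ?_ ?_ ?_ ?_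
  · rintro ⟨j, hj⟩
    fin_cases j
    · exact dvd_rfl
    · exact absurd rfl hj
    · exact (dvd_pow_self _ (by omega)).mul_left _
  · rintro ⟨j, hj⟩
    fin_cases j
    · simp [q]
    · exact absurd rfl hj
    · have h := Ideal.mul_mem_left _ (-C c⁻¹) (mem (binomial_mem_curveIdeal a c b))
      simp only [map_sub, map_mul, map_pow, dehomogenize_C, dehomogenize_X_self,
        dehomogenize_X_of_ne n0, dehomogenize_X_of_ne n2, one_pow, mul_one] at h
      have hcc : (C c * C c⁻¹ : MvPolynomial {j : Fin 3 // j ≠ 1} k) = 1 := by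
        rw [← C_mul, mul_inv_cancel₀ hc, C_1]
      convert h using 1
      simp only [q, div_eq_mul_inv, Fin.reduceFinMk, Fin.isValue, Fin.reduceEq, if_false,
        map_mul, map_pow, Polynomial.aeval_X, Polynomial.aeval_C, algebraMap_eq]
      linear_combination (-X ⟨2, n2⟩) * hcc
  · have h := mem (X_zero_pow_mem_curveIdeal ha c hb)
    rwa [map_pow, dehomogenize_X_of_ne n0] at h
  · intro f hf
    have hle : (curveIdeal a c b).map (dehomogenize 1)
        ≤ (Ideal.span {Polynomial.X ^ (b + 2)}).comap (aeval q) := by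
      rw [Ideal.map_le_iff_le_comap]
      intro g hg
      rw [Ideal.mem_comap, Ideal.mem_comap, Ideal.mem_span_singleton]
      have := X_pow_dvd_branchY_of_mem hc hb hg
      rwa [← hbranch] at this
    exact Ideal.mem_span_singleton.1 (hle hf)
  · ext ⟨j, hj⟩
    fin_cases j
    · simp [h0]
    · exact absurd rfl hj
    · simp [h2]

lemma hasLocalDegree_pointZ {a c : k} {b : ℕ} (hb : 1 ≤ b) :
    HasLocalDegree (curveIdeal a c b) (pointZ k) 2 := by
  intro v hv hP i hi
  obtain ⟨h0, h1⟩ := (mk_eq_pointZ_iff hv).1 hP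
  obtain rfl : i = 2 := by
    fin_cases i
    · exact absurd h0 hi
    · exact absurd h1 hi
    · rfl
  have n0 : (0 : Fin 3) ≠ 2 := by decide
  have n1 : (1 : Fin 3) ≠ 2 := by decide
  have mem : ∀ {f}, f ∈ curveIdeal a c b →
      dehomogenize 2 f ∈ (curveIdeal a c b).map (dehomogenize 2) := fun hf =>
    Ideal.mem_map_of_mem _ hf
  let q : {j : Fin 3 // j ≠ 2} → Polynomial k := fun j =>
    if j.1 = 0 then Polynomial.X else 0
  have hbranch : (aeval q).comp (dehomogenize 2) = branchZ k := by
    refine algHom_ext fun j => ?_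
    fin_cases j
    · simp [dehomogenize, branchZ, q]
    · simp [dehomogenize, branchZ, q]
    · simp [dehomogenize, branchZ]
  refine finrank_localization_eq (l := ⟨0, n0⟩) (q := q) rfl ?_ ?_ ?_ ?_ ?_
  · rintro ⟨j, hj⟩
    fin_cases j
    · exact dvd_rfl
    · exact dvd_zero _
    · exact absurd rfl hj
  · rintro ⟨j, hj⟩
    fin_cases j
    · simp [q]
    · have h := mem (yzz_mem_curveIdeal a c b)
      simp only [map_mul, map_pow, dehomogenize_X_self, dehomogenize_X_of_ne n1, one_pow,
        mul_one] at h
      simpa [q] using h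
    · exact absurd rfl hj
  · have h := mem (xxz_mem_curveIdeal a c b)
    rwa [map_mul, map_pow, dehomogenize_X_of_ne n0, dehomogenize_X_self, mul_one] at h
  · intro f hf
    have hle : (curveIdeal a c b).map (dehomogenize 2)
        ≤ (Ideal.span {Polynomial.X ^ 2}).comap (aeval q) := by
      rw [Ideal.map_le_iff_le_comap]
      intro g hg
      rw [Ideal.mem_comap, Ideal.mem_comap, Ideal.mem_span_singleton]
      have := X_pow_dvd_branchZ_of_mem hb hg
      rwa [← hbranch] at this
    exact Ideal.mem_span_singleton.1 (hle hf)
  · ext ⟨j, hj⟩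
    fin_cases j
    · simp [h0]
    · simp [h1]
    · exact absurd rfl hj

end Bourbaki

theorem proposition4p4 {k : Type*} [Field k] [IsAlgClosed k] (b : ℕ) (hb : 2 ≤ b)
    (hdeg : ((2 * b + 2 : ℕ) : k) ≠ 0) (hchar : ((2 * b + 1 : ℕ) : k) ≠ 0) :
    (Bourbaki.curve k b).IsHomogeneous (2 * b + 2) ∧
    Squarefree (Bourbaki.curve k b) ∧
    Bourbaki.HasBourbakiDegree (Bourbaki.curve k b) (b + 4) ∧
    Bourbaki.IsMinimalSyzygy (Bourbaki.curve k b) (Bourbaki.curveSyzygy k b) (b + 2) ∧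
    ∃ I : Ideal (MvPolynomial (Fin 3) k),
      (∀ I' : Ideal (MvPolynomial (Fin 3) k),
        Bourbaki.IsBourbakiIdeal (Bourbaki.curve k b) (Bourbaki.curveSyzygy k b) I' ↔ I' = I) ∧
      Bourbaki.zeros I = {Bourbaki.pointY k, Bourbaki.pointZ k} ∧
      Bourbaki.pointY k ≠ Bourbaki.pointZ k ∧
      Bourbaki.HasLocalDegree I (Bourbaki.pointY k) (b + 2) ∧
      Bourbaki.HasLocalDegree I (Bourbaki.pointZ k) 2 := by
  have hprod : (2 : k) * ((b : k) + 1) ≠ 0 := by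
    convert hdeg using 1
    push_cast
    ring
  have h2 : (2 : k) ≠ 0 := left_ne_zero_of_mul hprod
  have ha : (b : k) + 1 ≠ 0 := right_ne_zero_of_mul hprod
  have hc : 2 * (b : k) + 1 ≠ 0 := by
    convert hchar using 1
    push_cast
    ring
  have hI := Bourbaki.isBourbakiIdeal_curveIdeal hb ha hc h2
  refine ⟨Bourbaki.isHomogeneous_curve b, Bourbaki.squarefree_curve b,
    Bourbaki.hasBourbakiDegree_curve hb ha hc h2,
    Bourbaki.isMinimalSyzygy_curveSyzygy hb ha hc h2, _, fun I' => ⟨fun h => h.unique hI, ?_⟩,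
    Bourbaki.zeros_curveIdeal ha (by omega), Bourbaki.pointY_ne_pointZ,
    Bourbaki.hasLocalDegree_pointY ha hc (by omega),
    Bourbaki.hasLocalDegree_pointZ (by omega)⟩
  rintro rfl
  exact hI
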